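/- Let $\eta=\frac{1+\sqrt{-7}}{2}$, so that $\mathbb Z[\eta]$ is the ring of integers of $\mathbb Q(\sqrt{-7})$, and let $\chi$ be the Hecke Grössencharacter given on the ideal $(a+b\eta)$ by $$\chi((a+b\eta))=\left(\frac{a^3-2a^2b-ab^2+b^3}{7}\right)(a+b\eta),$$ where $\left(\frac{\cdot}{7}\right)$ is the Legendre symbol. For odd $k\ge 1$ let $L(s,\chi^k)$ be defined for $\operatorname{Re}s>1$ by the absolutely convergent series $$L(s,\chi^k)=\frac12\sum_{(a,b)\in\mathbb Z^2\setminus\{(0,0)\}}\frac{\chi((a+b\eta))^k}{(a^2+ab+2b^2)^{s+k/2}},$$ and elsewhere by analytic continuation. **Theorem 2 (second moment upper bound).** For every integer $n\ge1$ the function $L(s,\chi^{4n-3})$ extends to an entire function of $s$. There is an absolute constant $C$ such that for all integers $N\ge2$ $$\left|\frac1N\sum_{n=1}^{N}L(1/2,\chi^{4n-3})^2\right|\le C\log^2N.$$ Moreover (the convexity bound), there is an absolute constant $C'$ such that $|L(1/2,\chi^{4n-3})|\le C'\,n^{1/2}\log n$ for all integers $n\ge2$. -/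

import Mathlib

/-- The generator `η = (1 + √-7) / 2` of the ring of integers `ℤ[η]` of `ℚ(√-7)`. -/
noncomputable def eta : ℂ := (1 + (Real.sqrt 7 : ℂ) * Complex.I) / 2

/-- The norm of `a + b η`, for `p = (a, b)`. -/
def normForm (p : ℤ × ℤ) : ℤ := p.1 ^ 2 + p.1 * p.2 + 2 * p.2 ^ 2

instance factPrimeSeven : Fact (Nat.Prime 7) := ⟨by norm_num⟩

/-- The sign `ε_{a,b}` with `(a + b η)³ ≡ ε_{a,b} mod √-7`, given as a Legendre symbol;
it is `0` if `a + b η` is not coprime to `√-7`. -/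
def eps (p : ℤ × ℤ) : ℤ :=
  legendreSym 7 (p.1 ^ 3 - 2 * p.1 ^ 2 * p.2 - p.1 * p.2 ^ 2 + p.2 ^ 3)

/-- The Hecke character `χ((a + b η)) = ε_{a,b} (a + b η)`. -/
noncomputable def heckeChi (p : ℤ × ℤ) : ℂ := (eps p : ℂ) * ((p.1 : ℂ) + (p.2 : ℂ) * eta)

/-- The term of index `(a, b)` of the series
`L(s, χ^k) = ½ ∑_{(a,b) ≠ (0,0)} χ((a + b η))^k / (a² + a b + 2 b²)^(s + k/2)`
(analytic normalisation; every ideal has two generators). -/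
noncomputable def heckeTerm (k : ℕ) (s : ℂ) (p : ℤ × ℤ) : ℂ :=
  (1 / 2) * (heckeChi p ^ k / (normForm p : ℂ) ^ (s + (k : ℂ) / 2))

/-- `F` is the entire function `s ↦ L(s, χ^k)`: it is entire, and for `Re s > 1` it is the sum of
the (absolutely convergent) Hecke series. By the identity theorem at most one `F` satisfies this. -/
def IsHeckeL (k : ℕ) (F : ℂ → ℂ) : Prop :=
  Differentiable ℂ F ∧
    ∀ s : ℂ, 1 < s.re → HasSum (fun p : {p : ℤ × ℤ // p ≠ 0} => heckeTerm k s p) (F s)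

open Classical in
/-- The Hecke `L`-function `L(s, χ^k)`: the entire function that continues the Hecke series
(the zero function should no continuation exist). -/
noncomputable def heckeL (k : ℕ) : ℂ → ℂ :=
  if h : ∃ F : ℂ → ℂ, IsHeckeL k F then h.choose else 0

/-- The moment `(1/N) ∑_{n=1}^N L(1/2, χ^(4n-3))^r`. -/
noncomputable def moment (r N : ℕ) : ℂ :=
  (1 / (N : ℂ)) * ∑ n ∈ Finset.Icc 1 N, heckeL (4 * n - 3) (1 / 2) ^ r

/-! Write ψ for `eps`, the quadratic character modulo √-7. The theta series `theta k`, with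
coefficients ψ(α)α^k, satisfies a functional equation under t ↦ 1/t and decays faster than any power
at infinity, so its Mellin transform is entire. Since 1/Γ is also entire, this continues the Hecke
series (`isHeckeL_heckeMellin`). The functional equation is obtained for all k at once: Poisson
summation is applied to the generating series ∑ ψ(α) exp(-2πtN(α)/7 + wα), and coefficients of w^k
are compared.

At s = 1/2 and k = 2m+1, splitting the Mellin integral at t = 1 gives `heckeL_center`: up to a
factor of absolute value at most 1, the central value is the sum of ψ(α)α^k/N(α)^(m+1) weighted by a
Poisson tail. The weight lies in [0, 1] and is negligible once N(α) exceeds a constant times m + 1.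
Hence for n ≤ N all central values are, up to O(1), sums over one box of side R ≍ √N. Estimating
trivially by ∑ 1/|α| ≪ R gives the convexity bound.

The second moment is bounded by the mean square, which is expanded into pairs (α, β). Put D = αβ̄.
For a fixed pair the sum over n is a geometric series of ratio D⁴/|D|⁴ with increasing weights. The
ratio is 1 only if D is real or purely imaginary. The imaginary case would force 7 to divide
N(α)N(β), where ψ vanishes (`pairDet_mulSqrt_ne_zero`); the real case means that α and β are
parallel. Other pairs contribute at most the reciprocals of two integer determinants
(`norm_sum_pair_le`), and summing these over the box gives O(R² log R) (`sum_inv_det_le`).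

Parallel pairs have no cancellation in n. There the sum over β runs through multiples of a primitive
vector and carries the quadratic character modulo 7, whose partial sums are bounded
(`norm_sum_parallel_le`). This leaves ∑ gcd(α)/N(α) ≪ log² R for each n (`sum_gcd_div_normForm_le`).
The total is O(N log² N). -/

open Complex hiding eta
open Filter Topology Set MeasureTheory
open scoped Real

/-! ### Arithmetic of ℤ[η] and the character modulo √-7 -/

/-- The element `a + b η` of `ℤ[η]` attached to `p = (a, b)`. -/
noncomputable def latticePt (p : ℤ × ℤ) : ℂ := (p.1 : ℂ) + (p.2 : ℂ) * eta

lemma sqrt_seven_sq : (Real.sqrt 7 : ℂ) ^ 2 = 7 := by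
  rw [← ofReal_pow, Real.sq_sqrt (by norm_num)]; norm_num

lemma eta_sq : eta ^ 2 = eta - 2 := by
  unfold eta
  linear_combination (1 / 4 : ℂ) * I ^ 2 * sqrt_seven_sq + (7 / 4 : ℂ) * I_sq

lemma conj_eta : (starRingEnd ℂ) eta = 1 - eta := by
  unfold eta
  simp only [map_div₀, map_add, map_one, map_mul, conj_ofReal, conj_I, map_ofNat]
  ring

lemma normSq_latticePt (p : ℤ × ℤ) : normSq (latticePt p) = (normForm p : ℝ) := by
  have h : (normSq (latticePt p) : ℂ) = (normForm p : ℂ) := by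
    rw [normSq_eq_conj_mul_self]
    unfold latticePt normForm
    simp only [map_add, map_mul, map_intCast, conj_eta]
    push_cast
    linear_combination (-(p.2 : ℂ) ^ 2) * eta_sq
  exact_mod_cast h

lemma norm_latticePt_sq (p : ℤ × ℤ) : ‖latticePt p‖ ^ 2 = (normForm p : ℝ) := by
  rw [← normSq_latticePt, normSq_eq_norm_sq]

lemma norm_latticePt (p : ℤ × ℤ) : ‖latticePt p‖ = √(normForm p : ℝ) := by
  rw [← norm_latticePt_sq, Real.sqrt_sq (norm_nonneg _)]

lemma sq_add_sq_le_two_mul_normForm (p : ℤ × ℤ) : p.1 ^ 2 + p.2 ^ 2 ≤ 2 * normForm p := by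
  unfold normForm; nlinarith [sq_nonneg (p.1 + p.2)]

lemma normForm_nonneg (p : ℤ × ℤ) : 0 ≤ normForm p := by
  nlinarith [sq_add_sq_le_two_mul_normForm p, sq_nonneg p.1, sq_nonneg p.2]

lemma normForm_pos {p : ℤ × ℤ} (hp : p ≠ 0) : 0 < normForm p := by
  rcases p with ⟨a, b⟩
  have := sq_add_sq_le_two_mul_normForm (a, b)
  simp only at this
  by_cases ha : a = 0
  · have hb : b ≠ 0 := by rintro rfl; exact hp (by simp [ha])
    have : 0 < b ^ 2 := by positivity
    nlinarith [sq_nonneg a]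
  · have : 0 < a ^ 2 := by positivity
    nlinarith [sq_nonneg b]

lemma one_le_norm_latticePt {p : ℤ × ℤ} (hp : p ≠ 0) : 1 ≤ ‖latticePt p‖ := by
  have : (1 : ℝ) ≤ normForm p := by exact_mod_cast normForm_pos hp
  rw [norm_latticePt]; exact Real.one_le_sqrt.mpr this

/-- Since η ≡ 4 modulo √-7, the cubic form is (a + 4b)³ modulo 7, and a cube has the same quadratic
character as its base. -/
lemma eps_eq (p : ℤ × ℤ) : eps p = quadraticChar (ZMod 7) ((p.1 : ZMod 7) + 4 * (p.2 : ZMod 7)) := by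
  unfold eps legendreSym
  push_cast
  generalize (p.1 : ZMod 7) = x
  generalize (p.2 : ZMod 7) = y
  revert x y
  decide

lemma quadraticChar_seven (c : ZMod 7) : quadraticChar (ZMod 7) c =
    if c = 0 then 0 else if c = 1 ∨ c = 2 ∨ c = 4 then 1 else -1 := by
  revert c; decide

lemma eps_pow_odd (p : ℤ × ℤ) {k : ℕ} (hk : Odd k) : eps p ^ k = eps p := by
  rw [eps_eq, quadraticChar_seven]
  split_ifs
  · simp [hk.pos.ne']
  · simp
  · simp [hk.neg_one_pow]

lemma abs_eps_le_one (p : ℤ × ℤ) : |eps p| ≤ 1 := by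
  rw [eps_eq, quadraticChar_seven]; split_ifs <;> simp

lemma norm_eps_le_one (p : ℤ × ℤ) : ‖(eps p : ℂ)‖ ≤ 1 := by
  rw [Complex.norm_intCast]; exact_mod_cast abs_eps_le_one p

lemma eps_zero : eps 0 = 0 := by rw [eps_eq, quadraticChar_seven]; simp

/-- Modulo 7 the norm form is the square (a + 4b)². -/
lemma eps_eq_zero_of_dvd {p : ℤ × ℤ} (h : (7 : ℤ) ∣ normForm p) : eps p = 0 := by
  rw [eps_eq, quadraticChar_seven, if_pos]
  have h1 : ((normForm p : ℤ) : ZMod 7) = 0 := (ZMod.intCast_zmod_eq_zero_iff_dvd _ 7).mpr h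
  unfold normForm at h1
  push_cast at h1
  generalize (p.1 : ZMod 7) = x at *
  generalize (p.2 : ZMod 7) = y at *
  revert x y
  decide

lemma eps_smul (m : ℤ) (p : ℤ × ℤ) : eps (m • p) = quadraticChar (ZMod 7) (m : ZMod 7) * eps p := by
  rw [eps_eq, eps_eq, ← map_mul]
  congr 1
  simp only [Prod.smul_fst, Prod.smul_snd, smul_eq_mul]
  push_cast; ring

lemma latticePt_smul (m : ℤ) (p : ℤ × ℤ) : latticePt (m • p) = m * latticePt p := by
  simp only [latticePt, Prod.smul_fst, Prod.smul_snd, smul_eq_mul]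
  push_cast; ring

lemma normForm_smul (m : ℤ) (p : ℤ × ℤ) : normForm (m • p) = m ^ 2 * normForm p := by
  simp only [normForm, Prod.smul_fst, Prod.smul_snd, smul_eq_mul]
  ring

/-! ### Poisson summation for the binary form -/

lemma summable_exp_neg_sq_add_abs (r : ℝ) {c : ℝ} (hc : 0 < c) :
    Summable fun n : ℤ ↦ Real.exp (-c * n ^ 2 + r * |(n : ℝ)|) := by
  have h := summable_pow_mul_jacobiTheta₂_term_bound (r / (2 * π)) (T := c / π)
    (by positivity) 0
  refine h.congr fun n ↦ ?_
  rw [pow_zero, one_mul]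
  congr 1
  push_cast
  field_simp
  ring

lemma summable_exp_neg_sq_add_abs_prod (r : ℝ) {c : ℝ} (hc : 0 < c) :
    Summable fun p : ℤ × ℤ ↦ Real.exp (-c * ((p.1 : ℝ) ^ 2 + (p.2 : ℝ) ^ 2)
      + r * (|(p.1 : ℝ)| + |(p.2 : ℝ)|)) := by
  have h := summable_exp_neg_sq_add_abs r hc
  refine (h.mul_of_nonneg h (fun _ ↦ (Real.exp_pos _).le) fun _ ↦ (Real.exp_pos _).le).congr
    fun p ↦ ?_
  rw [← Real.exp_add]
  congr 1
  ring

/-- The general term of the two-dimensional theta series attached to `normForm`. -/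
noncomputable def gaussTerm (τ u v : ℂ) (p : ℤ × ℤ) : ℂ :=
  cexp (π * I * τ * (normForm p : ℂ) + 2 * π * I * (p.1 * u + p.2 * v))

lemma norm_gaussTerm (τ u v : ℂ) (p : ℤ × ℤ) : ‖gaussTerm τ u v p‖ =
    Real.exp (-π * τ.im * normForm p - 2 * π * (p.1 * u.im + p.2 * v.im)) := by
  rw [gaussTerm, Complex.norm_exp]
  congr 1
  have : (π * I * τ * (normForm p : ℂ) + 2 * π * I * (p.1 * u + p.2 * v) : ℂ) =
      ((π * normForm p : ℝ) : ℂ) * τ * I + ((2 * π * p.1 : ℝ) : ℂ) * u * I +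
        ((2 * π * p.2 : ℝ) : ℂ) * v * I := by push_cast; ring
  rw [this, add_re, add_re, mul_I_re, mul_I_re, mul_I_re, im_ofReal_mul, im_ofReal_mul,
    im_ofReal_mul]
  ring

lemma half_sq_add_sq_le_normForm (p : ℤ × ℤ) :
    ((p.1 : ℝ) ^ 2 + (p.2 : ℝ) ^ 2) / 2 ≤ normForm p := by
  have := sq_add_sq_le_two_mul_normForm p
  have : ((p.1 : ℝ) ^ 2 + (p.2 : ℝ) ^ 2) ≤ 2 * normForm p := by exact_mod_cast this
  linarith

lemma summable_gaussTerm {τ : ℂ} (hτ : 0 < τ.im) (u v : ℂ) : Summable (gaussTerm τ u v) := by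
  refine (summable_exp_neg_sq_add_abs_prod (2 * π * (|u.im| + |v.im|))
    (c := π * τ.im / 2) (by positivity)).of_norm_bounded fun p ↦ ?_
  rw [norm_gaussTerm, Real.exp_le_exp]
  have h1 := mul_le_mul_of_nonneg_left (half_sq_add_sq_le_normForm p)
    (by positivity : 0 ≤ π * τ.im)
  have h2 : -((p.1 : ℝ) * u.im + p.2 * v.im) ≤ (|u.im| + |v.im|) * (|(p.1 : ℝ)| + |(p.2 : ℝ)|) := by
    have ha := neg_abs_le ((p.1 : ℝ) * u.im)
    have hb := neg_abs_le ((p.2 : ℝ) * v.im)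
    rw [abs_mul] at ha hb
    have := mul_nonneg (abs_nonneg (p.1 : ℝ)) (abs_nonneg v.im)
    have := mul_nonneg (abs_nonneg (p.2 : ℝ)) (abs_nonneg u.im)
    nlinarith
  have h3 := mul_le_mul_of_nonneg_left h2 (by positivity : 0 ≤ 2 * π)
  linarith

/-- Poisson summation one variable at a time. Jacobi's functional equation in a leaves, after
completing the square, a theta function in b of modulus 7τ/4, to which it is applied again. The
inverse form becomes the original one after a quarter turn of the coordinates, hence the arguments
(v - p.1, -u - p.2). -/
lemma tsum_gaussTerm_eq {y : ℝ} (hy : 0 < y) (u v : ℂ) :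
    ∑' p, gaussTerm (I * y) u v p = 2 / (√7 * y) * ∑' p : ℤ × ℤ,
      cexp (-(4 * π / (7 * y)) *
        ((v - p.1) ^ 2 + (v - p.1) * (-u - p.2) + 2 * (-u - p.2) ^ 2)) := by
  have hyC : (y : ℂ) ≠ 0 := by exact_mod_cast hy.ne'
  set τ : ℂ := I * y with hτ
  have hτ0 : τ ≠ 0 := mul_ne_zero I_ne_zero hyC
  have him : 0 < τ.im := by simp [hτ, hy]
  have him2 : 0 < (7 * τ / 4).im := by
    rw [show 7 * τ / 4 = ((7 / 4 * y : ℝ) : ℂ) * I by rw [hτ]; push_cast; ring, im_ofReal_mul]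
    simp [hy]
  have him3 : 0 < (-1 / τ).im := by
    rw [show -1 / τ = ((1 / y : ℝ) : ℂ) * I by
      rw [hτ, div_eq_iff (mul_ne_zero I_ne_zero hyC)]; push_cast; field_simp
      linear_combination (-1 : ℂ) * I_sq, im_ofReal_mul]
    simp [hy]
  have hs := summable_gaussTerm him u v
  set c₁ : ℂ := 1 / (-I * τ) ^ (1 / 2 : ℂ)
  set c₂ : ℂ := 1 / (-I * (7 * τ / 4)) ^ (1 / 2 : ℂ)
  have hc : c₁ * c₂ = 2 / (√7 * y) := by
    have e1 : -I * τ = (y : ℂ) := by rw [hτ]; linear_combination (-(y : ℂ)) * I_sq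
    have e2 : -I * (7 * τ / 4) = ((7 / 4 * y : ℝ) : ℂ) := by
      rw [hτ]; push_cast; linear_combination (-(7 / 4 * y : ℂ)) * I_sq
    have e3 : (1 / 2 : ℂ) = ((1 / 2 : ℝ) : ℂ) := by push_cast; ring
    simp only [c₁, c₂]
    rw [e1, e2, e3, ← ofReal_cpow hy.le, ← ofReal_cpow (by positivity), ← Real.sqrt_eq_rpow,
      ← Real.sqrt_eq_rpow]
    norm_cast
    have : √y * √(7 / 4 * y) = √7 * y / 2 := by
      rw [← Real.sqrt_mul hy.le, show y * (7 / 4 * y) = 7 * (y / 2) ^ 2 by ring,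
        Real.sqrt_mul (by norm_num), Real.sqrt_sq (by positivity)]
      ring
    rw [div_mul_div_comm, this]
    field_simp
  -- The summand once the sum over a has been replaced by its dual sum over m.
  let H : ℤ → ℤ → ℂ := fun m b ↦ cexp (-π * I * (u - m) ^ 2 / τ) *
    jacobiTheta₂_term b (v - u / 2 + m / 2) (7 * τ / 4)
  have step1 (b : ℤ) : ∑' a : ℤ, gaussTerm τ u v (a, b) = c₁ * ∑' m : ℤ, H m b := by
    have e (a : ℤ) : gaussTerm τ u v (a, b) =
        cexp (2 * π * I * τ * b ^ 2 + 2 * π * I * b * v) *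
          jacobiTheta₂_term a (u + b * τ / 2) τ := by
      rw [gaussTerm, jacobiTheta₂_term, ← Complex.exp_add]
      congr 1
      simp only [normForm]; push_cast; ring
    rw [tsum_congr e, tsum_mul_left]
    change _ * jacobiTheta₂ _ _ = _
    rw [jacobiTheta₂_functional_equation, jacobiTheta₂]
    rw [show ∀ A B C D : ℂ, A * (B * C * D) = B * (A * C * D) from fun _ _ _ _ ↦ by ring,
      ← tsum_mul_left]
    congr 1
    refine tsum_congr fun m ↦ ?_
    simp only [H, jacobiTheta₂_term]
    rw [← Complex.exp_add, ← Complex.exp_add, ← Complex.exp_add]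
    congr 1
    field_simp
    ring
  -- The shift m/2 in the second theta term is real and does not affect its norm, so the double
  -- series is dominated by a product of two one-variable series.
  have hH : Summable fun q : ℤ × ℤ ↦ H q.1 q.2 := by
    have h1 := ((summable_jacobiTheta₂_term_iff (u / τ) (-1 / τ)).mpr him3).norm
    have h2 := ((summable_jacobiTheta₂_term_iff (v - u / 2) (7 * τ / 4)).mpr him2).norm
    have h3 := (h1.mul_of_nonneg h2 (fun _ ↦ norm_nonneg _) fun _ ↦ norm_nonneg _).mul_left
      ‖cexp (-π * I * u ^ 2 / τ)‖
    refine h3.of_norm_bounded fun q ↦ le_of_eq ?_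
    have e1 : ‖jacobiTheta₂_term q.2 (v - u / 2 + q.1 / 2) (7 * τ / 4)‖ =
        ‖jacobiTheta₂_term q.2 (v - u / 2) (7 * τ / 4)‖ := by
      rw [norm_jacobiTheta₂_term, norm_jacobiTheta₂_term]
      congr 3
      simp
    have e2 : cexp (-π * I * u ^ 2 / τ) * jacobiTheta₂_term q.1 (u / τ) (-1 / τ) =
        cexp (-π * I * (u - q.1) ^ 2 / τ) := by
      rw [jacobiTheta₂_term, ← Complex.exp_add]
      congr 1
      field_simp
      ring
    simp only [H]
    rw [norm_mul, e1, ← e2, norm_mul, mul_assoc]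
  have step2 (m : ℤ) : ∑' b : ℤ, H m b = c₂ * ∑' n : ℤ, cexp (-(4 * π / (7 * y)) *
        ((v - n) ^ 2 + (v - n) * (-u - (-m : ℤ)) + 2 * (-u - (-m : ℤ)) ^ 2)) := by
    simp only [H]
    rw [tsum_mul_left]
    change _ * jacobiTheta₂ _ _ = _
    rw [jacobiTheta₂_functional_equation, jacobiTheta₂]
    rw [show ∀ A B C D : ℂ, A * (B * C * D) = B * (A * C * D) from fun _ _ _ _ ↦ by ring,
      ← tsum_mul_left]
    congr 1
    refine tsum_congr fun n ↦ ?_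
    rw [jacobiTheta₂_term, ← Complex.exp_add, ← Complex.exp_add]
    congr 1
    rw [hτ]
    field_simp
    push_cast
    ring
  have hK : Summable fun p : ℤ × ℤ ↦ cexp (-(4 * π / (7 * y)) *
        ((v - p.1) ^ 2 + (v - p.1) * (-u - p.2) + 2 * (-u - p.2) ^ 2)) := by
    -- Up to a constant factor the dual series is again a Gaussian series, with complex shifts.
    set τ' : ℂ := ((4 / (7 * y) : ℝ) : ℂ) * I with hτ'
    have := (summable_gaussTerm (τ := τ')
      (by rw [im_ofReal_mul]; simp; positivity)
      (-τ' * (2 * v - u) / 2) (-τ' * (v - 4 * u) / 2)).mul_left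
        (cexp (-(4 * π / (7 * y)) * (v ^ 2 - u * v + 2 * u ^ 2)))
    refine this.congr fun p ↦ ?_
    rw [gaussTerm, ← Complex.exp_add]
    congr 1
    simp only [normForm, hτ']
    push_cast
    field_simp
    ring_nf
    simp only [I_sq]
    ring
  calc ∑' p, gaussTerm τ u v p = ∑' b : ℤ, ∑' a : ℤ, gaussTerm τ u v (a, b) := by
        rw [← (Equiv.prodComm ℤ ℤ).tsum_eq]
        exact Summable.tsum_prod ((Equiv.prodComm ℤ ℤ).summable_iff.mpr hs)
    _ = c₁ * ∑' b : ℤ, ∑' m : ℤ, H m b := by rw [tsum_congr step1, tsum_mul_left]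
    _ = c₁ * ∑' m : ℤ, ∑' b : ℤ, H m b := by
        rw [Summable.tsum_comm (f := fun b m ↦ H m b)]
        exact (Equiv.prodComm ℤ ℤ).summable_iff.mpr hH
    _ = c₁ * c₂ * ∑' m : ℤ, ∑' n : ℤ, cexp (-(4 * π / (7 * y)) *
        ((v - n) ^ 2 + (v - n) * (-u - (-m : ℤ)) + 2 * (-u - (-m : ℤ)) ^ 2)) := by
        rw [tsum_congr step2, tsum_mul_left, mul_assoc]
    _ = _ := by
        rw [hc]
        congr 1
        generalize hf : (fun p : ℤ × ℤ ↦ cexp (-(4 * π / (7 * y)) *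
          ((v - p.1) ^ 2 + (v - p.1) * (-u - p.2) + 2 * (-u - p.2) ^ 2))) = f at hK
        have hf' (m n : ℤ) : cexp (-(4 * π / (7 * y)) *
            ((v - n) ^ 2 + (v - n) * (-u - (-m : ℤ)) + 2 * (-u - (-m : ℤ)) ^ 2)) = f (n, -m) := by
          rw [← hf]
        simp only [hf']
        let e : ℤ × ℤ ≃ ℤ × ℤ := (Equiv.prodComm ℤ ℤ).trans ((Equiv.refl ℤ).prodCongr (Equiv.neg ℤ))
        have := Summable.tsum_prod (e.summable_iff.mpr hK)
        rw [← e.tsum_eq]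
        exact this.symm

/-! ### The quadratic Gauss sum modulo 7 -/

/-- The quadratic character modulo `7`, on integers, with complex values. -/
noncomputable def quad7 (m : ℤ) : ℂ := (quadraticChar (ZMod 7) (m : ZMod 7) : ℂ)

lemma quad7_add (m n : ℤ) : quad7 (m + 7 * n) = quad7 m := by
  unfold quad7
  congr 2
  push_cast
  rw [show (7 : ZMod 7) = 0 from rfl]
  ring

lemma eps_eq_quad7 (p : ℤ × ℤ) : (eps p : ℂ) = quad7 (p.1 + 4 * p.2) := by
  rw [eps_eq, quad7]; push_cast; rfl

lemma quad7_values : quad7 0 = 0 ∧ quad7 1 = 1 ∧ quad7 2 = 1 ∧ quad7 3 = -1 ∧ quad7 4 = 1 ∧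
    quad7 5 = -1 ∧ quad7 6 = -1 := by
  simp only [quad7]
  norm_cast

/-- The quadratic Gauss sum modulo `7`. -/
noncomputable def gauss7 : ℂ := ∑ j : Fin 7, quad7 (j : ℕ) * cexp (2 * π * I * (j : ℕ) / 7)

/-- The primitive seventh root of unity `exp (2 π i / 7)`. -/
noncomputable def zeta7 : ℂ := cexp (2 * π * I / 7)

lemma zeta7_pow : zeta7 ^ 7 = 1 := by
  rw [zeta7, ← Complex.exp_nat_mul, ← Complex.exp_two_pi_mul_I]
  congr 1; push_cast; ring

lemma exp_eq_zeta7_pow (n : ℕ) : cexp (2 * π * I * n / 7) = zeta7 ^ n := by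
  rw [zeta7, ← Complex.exp_nat_mul]
  congr 1; ring

lemma exp_int_eq_zeta7_pow (j : ℕ) (c : ℤ) :
    cexp (2 * π * I * j * c / 7) = zeta7 ^ (j * (c % 7).toNat) := by
  rw [← exp_eq_zeta7_pow, Complex.exp_eq_exp_iff_exists_int]
  refine ⟨j * (c / 7), ?_⟩
  have h : ((c % 7).toNat : ℤ) = c % 7 := Int.toNat_of_nonneg (Int.emod_nonneg _ (by norm_num))
  have h2 : (c : ℂ) = 7 * ((c / 7 : ℤ) : ℂ) + ((c % 7).toNat : ℂ) := by
    have : c = 7 * (c / 7) + ((c % 7).toNat : ℤ) := by rw [h]; omega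
    exact_mod_cast this
  push_cast
  generalize ((c / 7 : ℤ) : ℂ) = x at *
  rw [h2]
  ring

lemma gauss7_eq : gauss7 =
    zeta7 + zeta7 ^ 2 - zeta7 ^ 3 + zeta7 ^ 4 - zeta7 ^ 5 - zeta7 ^ 6 := by
  simp only [gauss7, exp_eq_zeta7_pow]
  obtain ⟨h0, h1, h2, h3, h4, h5, h6⟩ := quad7_values
  simp [Fin.sum_univ_succ, h0, h1, h2, h3, h4, h5, h6]
  ring

lemma gauss7_sq : gauss7 ^ 2 = -7 := by
  have h : 1 + zeta7 + zeta7 ^ 2 + zeta7 ^ 3 + zeta7 ^ 4 + zeta7 ^ 5 + zeta7 ^ 6 = 0 := by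
    have h1 : zeta7 ≠ 1 := by
      intro h
      rw [zeta7, Complex.exp_eq_one_iff] at h
      obtain ⟨n, hn⟩ := h
      have hpi : (2 * π * I : ℂ) ≠ 0 := two_pi_I_ne_zero
      have : (n : ℂ) * 7 = 1 := by
        have : (2 * π * I : ℂ) * (n * 7) = 2 * π * I * 1 := by linear_combination (-7 : ℂ) * hn
        exact mul_left_cancel₀ hpi this
      have h3 : n * 7 = 1 := by exact_mod_cast this
      omega
    have h2 : (zeta7 - 1) * (1 + zeta7 + zeta7 ^ 2 + zeta7 ^ 3 + zeta7 ^ 4 + zeta7 ^ 5 +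
        zeta7 ^ 6) = 0 := by linear_combination zeta7_pow
    exact (mul_eq_zero.mp h2).resolve_left (sub_ne_zero.mpr h1)
  rw [gauss7_eq]
  have h7 := zeta7_pow
  generalize zeta7 = z at *
  have h8 : z ^ 8 = z := by rw [pow_succ, h7, one_mul]
  have h10 : z ^ 10 = z ^ 3 := by rw [show z ^ 10 = z ^ 7 * z ^ 3 by ring, h7, one_mul]
  have h11 : z ^ 11 = z ^ 4 := by rw [show z ^ 11 = z ^ 7 * z ^ 4 by ring, h7, one_mul]
  have h12 : z ^ 12 = z ^ 5 := by rw [show z ^ 12 = z ^ 7 * z ^ 5 by ring, h7, one_mul]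
  ring_nf
  simp only [h7, h8, h10, h11, h12]
  linear_combination h

lemma norm_gauss7 : ‖gauss7‖ = √7 := by
  have : ‖gauss7‖ ^ 2 = 7 := by rw [← norm_pow, gauss7_sq]; simp
  rw [← this, Real.sqrt_sq (norm_nonneg _)]

/-- Expands the character into additive characters, so that twisting a Gaussian series by ψ amounts
to shifting its parameters u and v. Checked for each residue of c. -/
lemma gauss7_mul_quad7 (c : ℤ) : quad7 c * gauss7 =
    ∑ j : Fin 7, quad7 (j : ℕ) * cexp (2 * π * I * (j : ℕ) * c / 7) := by
  simp only [exp_int_eq_zeta7_pow, gauss7_eq]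
  have hc : quad7 c = quad7 (c % 7) := by
    conv_lhs => rw [← Int.emod_add_mul_ediv c 7]
    exact quad7_add _ _
  rw [hc]
  have h0 := Int.emod_nonneg c (by norm_num : (7 : ℤ) ≠ 0)
  have h1 := Int.emod_lt_of_pos c (by norm_num : (0 : ℤ) < 7)
  generalize c % 7 = d at *
  have h7 := zeta7_pow
  generalize zeta7 = z at *
  have key (q r : ℕ) : z ^ (7 * q + r) = z ^ r := by rw [pow_add, pow_mul, h7, one_pow, one_mul]
  have h8 : z ^ 8 = z := by simpa using key 1 1
  have h9 : z ^ 9 = z ^ 2 := key 1 2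
  have h10 : z ^ 10 = z ^ 3 := key 1 3
  have h12 : z ^ 12 = z ^ 5 := key 1 5
  have h15 : z ^ 15 = z := by simpa using key 2 1
  have h16 : z ^ 16 = z ^ 2 := key 2 2
  have h18 : z ^ 18 = z ^ 4 := key 2 4
  have h20 : z ^ 20 = z ^ 6 := key 2 6
  have h24 : z ^ 24 = z ^ 3 := key 3 3
  have h25 : z ^ 25 = z ^ 4 := key 3 4
  have h30 : z ^ 30 = z ^ 2 := key 4 2
  have h36 : z ^ 36 = z := by simpa using key 5 1
  obtain ⟨q0, q1, q2, q3, q4, q5, q6⟩ := quad7_values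
  clear hc
  interval_cases d <;>
    simp [Fin.sum_univ_succ, q0, q1, q2, q3, q4, q5, q6] <;>
    (try simp only [h8, h9, h10, h12, h15, h16, h18, h20, h24, h25, h30, h36]) <;> ring

/-! ### Functional equation of the twisted generating series -/

/-- The generating series `∑ ψ(α) exp (-2 π t N(α) / 7 + w α)` of the theta series. -/
noncomputable def thetaGenTerm (t : ℝ) (w : ℂ) (p : ℤ × ℤ) : ℂ :=
  eps p * cexp (-(2 * π / 7) * t * normForm p + w * latticePt p)

lemma exp_eq_gaussTerm (t : ℝ) (w : ℂ) (p : ℤ × ℤ) :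
    cexp (-(2 * π / 7) * t * normForm p + w * latticePt p) =
      gaussTerm (I * (2 * t / 7 : ℝ)) (w / (2 * π * I)) (w * eta / (2 * π * I)) p := by
  have hpi : (π : ℂ) ≠ 0 := by exact_mod_cast Real.pi_ne_zero
  rw [gaussTerm, latticePt]
  congr 1
  push_cast
  field_simp
  linear_combination (-(2 * π * t * normForm p : ℂ)) * I_sq

lemma summable_exp_normForm {t : ℝ} (ht : 0 < t) (w : ℂ) : Summable fun p : ℤ × ℤ ↦
    cexp (-(2 * π / 7) * t * normForm p + w * latticePt p) := by
  simp only [exp_eq_gaussTerm]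
  exact summable_gaussTerm (by simpa using ht) _ _

lemma summable_thetaGenTerm {t : ℝ} (ht : 0 < t) (w : ℂ) : Summable (thetaGenTerm t w) := by
  refine (summable_exp_normForm ht w).norm.of_norm_bounded fun p ↦ ?_
  rw [thetaGenTerm, norm_mul]
  exact mul_le_of_le_one_left (norm_nonneg _) (norm_eps_le_one p)

/-- The bijection `(j, a, b) ↦ (a + 4 b, j - 2 a - b)`: the residue `j` together with a point of the
lattice of multiples of `√-7` parametrises `ℤ × ℤ`. -/
def residueEquiv : Fin 7 × ℤ × ℤ ≃ ℤ × ℤ where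
  toFun x := (x.2.1 + 4 * x.2.2, (x.1 : ℕ) - 2 * x.2.1 - x.2.2)
  invFun q := (⟨((2 * q.1 + q.2) % 7).toNat, by omega⟩, q.1 - 4 * ((2 * q.1 + q.2) / 7),
    (2 * q.1 + q.2) / 7)
  left_inv := by
    rintro ⟨⟨j, hj⟩, a, b⟩
    simp only [Prod.mk.injEq, Fin.mk.injEq]
    omega
  right_inv := by
    rintro ⟨e, f⟩
    simp only [Prod.mk.injEq]
    omega

/-- After the Gauss sum expansion each residue j is handled by `tsum_gaussTerm_eq`. No factor
quadratic in w appears because η² - η + 2 = 0, so (η, -1) is isotropic for the form; this is the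
harmonicity of the polynomials α^k. -/
lemma thetaGen_functional_equation {t : ℝ} (ht : 0 < t) (w : ℂ) :
    gauss7 * ∑' p, thetaGenTerm t w p = √7 / t * ∑' p, thetaGenTerm (1 / t) (I * w / t) p := by
  have hpi : (π : ℂ) ≠ 0 := by exact_mod_cast Real.pi_ne_zero
  have htC : (t : ℂ) ≠ 0 := by exact_mod_cast ht.ne'
  have h7 : (√7 : ℂ) ≠ 0 := by
    exact_mod_cast (Real.sqrt_pos.mpr (by norm_num : (0 : ℝ) < 7)).ne'
  have hy : 0 < 2 * t / 7 := by positivity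
  set u : Fin 7 → ℂ := fun j ↦ (j : ℕ) / 7 + w / (2 * π * I) with hu
  set v : Fin 7 → ℂ := fun j ↦ 4 * (j : ℕ) / 7 + w * eta / (2 * π * I) with hv
  have e1 (p : ℤ × ℤ) : gauss7 * thetaGenTerm t w p =
      ∑ j : Fin 7, quad7 (j : ℕ) * gaussTerm (I * (2 * t / 7 : ℝ)) (u j) (v j) p := by
    rw [thetaGenTerm, exp_eq_gaussTerm, ← mul_assoc, mul_comm gauss7, eps_eq_quad7,
      gauss7_mul_quad7, Finset.sum_mul]
    refine Finset.sum_congr rfl fun j _ ↦ ?_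
    rw [mul_assoc, gaussTerm, gaussTerm, ← Complex.exp_add]
    congr 2
    simp only [hu, hv]
    push_cast
    field_simp
    ring
  have e2 (j : Fin 7) (x : ℤ × ℤ) : quad7 (j : ℕ) * cexp (-(4 * π / (7 * (2 * t / 7 : ℝ))) *
        ((v j - x.1) ^ 2 + (v j - x.1) * (-u j - x.2) + 2 * (-u j - x.2) ^ 2)) =
      thetaGenTerm (1 / t) (I * w / t) (residueEquiv (j, x)) := by
    -- The image (e, f) satisfies e + 4f ≡ 4j modulo 7, and 4 is a square.
    have hj : quad7 (j : ℕ) = eps (residueEquiv (j, x)) := by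
      rw [eps_eq_quad7]
      have : (residueEquiv (j, x)).1 + 4 * (residueEquiv (j, x)).2 =
          4 * (j : ℕ) + 7 * (-x.1) := by simp only [residueEquiv, Equiv.coe_fn_mk]; ring
      rw [this, quad7_add]
      unfold quad7
      push_cast
      congr 1
      generalize ((j : ℕ) : ZMod 7) = c
      revert c; decide
    rw [thetaGenTerm, hj]
    congr 2
    simp only [latticePt, normForm, residueEquiv, Equiv.coe_fn_mk, hu, hv]
    push_cast
    field_simp
    ring_nf
    simp only [show eta ^ 2 = eta - 2 from eta_sq, I_sq, show I ^ 3 = -I by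
      rw [pow_succ, I_sq]; ring]
    ring
  have hs := residueEquiv.summable_iff.mpr
    (summable_thetaGenTerm (one_div_pos.mpr ht) (I * w / t))
  calc gauss7 * ∑' p, thetaGenTerm t w p
      = ∑' p, ∑ j : Fin 7, quad7 (j : ℕ) * gaussTerm (I * (2 * t / 7 : ℝ)) (u j) (v j) p := by
        rw [← tsum_mul_left, tsum_congr e1]
    _ = ∑ j : Fin 7, quad7 (j : ℕ) * ∑' p, gaussTerm (I * (2 * t / 7 : ℝ)) (u j) (v j) p := by
        rw [Summable.tsum_finsetSum fun j _ ↦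
          (summable_gaussTerm (by simpa using ht) _ _).mul_left _]
        simp only [tsum_mul_left]
    _ = √7 / t * ∑ j : Fin 7, ∑' x, thetaGenTerm (1 / t) (I * w / t) (residueEquiv (j, x)) := by
        rw [Finset.mul_sum]
        refine Finset.sum_congr rfl fun j _ ↦ ?_
        rw [tsum_gaussTerm_eq hy, ← mul_assoc, mul_comm (quad7 _), mul_assoc, ← tsum_mul_left,
          tsum_congr (e2 j)]
        congr 1
        push_cast
        have : (√7 : ℂ) ^ 2 = 7 := sqrt_seven_sq
        field_simp
        linear_combination (-1 : ℂ) * this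
    _ = √7 / t * ∑' p, thetaGenTerm (1 / t) (I * w / t) p := by
        rw [← residueEquiv.tsum_eq]
        congr 1
        exact ((Summable.tsum_prod hs).trans (tsum_fintype _)).symm

/-! ### Theta series with the weights α^k -/

lemma eq_of_forall_hasSum_pow_mul {a b : ℕ → ℂ} {f : ℂ → ℂ}
    (ha : ∀ w, HasSum (fun n ↦ w ^ n * a n) (f w)) (hb : ∀ w, HasSum (fun n ↦ w ^ n * b n) (f w)) :
    a = b := by
  have key (c : ℕ → ℂ) (hc : ∀ w, HasSum (fun n ↦ w ^ n * c n) (f w)) :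
      HasFPowerSeriesAt f (FormalMultilinearSeries.ofScalars ℂ c) 0 := by
    rw [hasFPowerSeriesAt_iff]
    refine Eventually.of_forall fun z ↦ ?_
    simpa [FormalMultilinearSeries.coeff_ofScalars] using hc z
  have h := (key a ha).eq_formalMultilinearSeries (key b hb)
  funext n
  have := congrArg (fun p : FormalMultilinearSeries ℂ ℂ ℂ ↦ p.coeff n) h
  simpa [FormalMultilinearSeries.coeff_ofScalars] using this

/-- The general term of the theta series with harmonic polynomial `α ^ k`. -/
noncomputable def thetaTerm (k : ℕ) (t : ℝ) (p : ℤ × ℤ) : ℂ :=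
  eps p * latticePt p ^ k * (Real.exp (-(2 * π / 7 * normForm p) * t) : ℂ)

/-- The theta series `∑ ψ(α) α ^ k exp (-2 π t N(α) / 7)`. -/
noncomputable def theta (k : ℕ) (t : ℝ) : ℂ := ∑' p, thetaTerm k t p

lemma thetaGenTerm_hasSum (t : ℝ) (w : ℂ) (p : ℤ × ℤ) :
    HasSum (fun k : ℕ ↦ w ^ k * (thetaTerm k t p / k.factorial)) (thetaGenTerm t w p) := by
  have h := (NormedSpace.expSeries_div_hasSum_exp (w * latticePt p)).mul_left
    (eps p * (Real.exp (-(2 * π / 7 * normForm p) * t) : ℂ))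
  rw [← Complex.exp_eq_exp_ℂ] at h
  convert! h using 1
  · funext k
    rw [thetaTerm, mul_pow]
    ring
  · rw [thetaGenTerm, mul_assoc (eps p : ℂ) (Real.exp _ : ℂ), ofReal_exp, ← Complex.exp_add]
    push_cast
    congr 2
    ring

/-- The domination that allows the Taylor expansion of exp(wα) to be exchanged with the lattice sum:
the quadratic exponent beats the linear one. -/
lemma summable_exp_normForm_add_norm {t : ℝ} (ht : 0 < t) (r : ℝ) : Summable fun p : ℤ × ℤ ↦
    Real.exp (-(2 * π / 7 * normForm p) * t) * Real.exp (r * ‖latticePt p‖) := by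
  refine Summable.of_nonneg_of_le (fun p ↦ by positivity) (fun p ↦ ?_)
    ((summable_exp_neg_sq_add_abs_prod (|r| * (1 + ‖eta‖)) (c := π / 7 * t) (by positivity)))
  rw [← Real.exp_add, Real.exp_le_exp]
  have h1 := mul_le_mul_of_nonneg_left (half_sq_add_sq_le_normForm p)
    (by positivity : 0 ≤ 2 * π / 7 * t)
  have h2 : ‖latticePt p‖ ≤ (1 + ‖eta‖) * (|(p.1 : ℝ)| + |(p.2 : ℝ)|) := by
    unfold latticePt
    refine (norm_add_le _ _).trans ?_
    rw [norm_mul, norm_intCast, norm_intCast]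
    nlinarith [norm_nonneg eta, abs_nonneg (p.1 : ℝ), abs_nonneg (p.2 : ℝ),
      mul_nonneg (norm_nonneg eta) (abs_nonneg (p.1 : ℝ))]
  have h3 : r * ‖latticePt p‖ ≤ |r| * ((1 + ‖eta‖) * (|(p.1 : ℝ)| + |(p.2 : ℝ)|)) :=
    (mul_le_mul_of_nonneg_right (le_abs_self r) (norm_nonneg _)).trans
      (mul_le_mul_of_nonneg_left h2 (abs_nonneg r))
  linarith

lemma hasSum_exp_coeff (x : ℝ) : HasSum (fun k : ℕ ↦ x ^ k / k.factorial) (Real.exp x) := by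
  rw [Real.exp_eq_exp_ℝ]
  exact NormedSpace.expSeries_div_hasSum_exp x

lemma norm_thetaTerm_le (k : ℕ) (t : ℝ) (p : ℤ × ℤ) : ‖thetaTerm k t p‖ ≤
    Real.exp (-(2 * π / 7 * normForm p) * t) * ‖latticePt p‖ ^ k := by
  rw [thetaTerm, norm_mul, norm_mul, norm_pow, norm_real, Real.norm_of_nonneg (Real.exp_pos _).le,
    mul_comm]
  gcongr
  exact mul_le_of_le_one_left (by positivity) (norm_eps_le_one p)

lemma pow_le_factorial_mul_exp {x : ℝ} (hx : 0 ≤ x) (k : ℕ) : x ^ k ≤ k.factorial * Real.exp x := by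
  have := Real.pow_div_factorial_le_exp x hx k
  rwa [div_le_iff₀' (by positivity)] at this

lemma summable_exp_mul_norm_pow {t : ℝ} (ht : 0 < t) (k : ℕ) : Summable fun p : ℤ × ℤ ↦
    Real.exp (-(2 * π / 7 * normForm p) * t) * ‖latticePt p‖ ^ k := by
  refine Summable.of_nonneg_of_le (fun p ↦ by positivity) (fun p ↦ ?_)
    ((summable_exp_normForm_add_norm ht 1).mul_left (k.factorial : ℝ))
  rw [mul_left_comm, one_mul]
  gcongr
  exact pow_le_factorial_mul_exp (norm_nonneg _) k

lemma summable_thetaTerm {t : ℝ} (ht : 0 < t) (k : ℕ) : Summable (thetaTerm k t) :=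
  (summable_exp_mul_norm_pow ht k).of_norm_bounded (norm_thetaTerm_le k t)

lemma hasSum_tsum_comm {α β : Type*} {F : α → β → ℂ} (hs : Summable fun x : α × β ↦ F x.1 x.2) :
    HasSum (fun b ↦ ∑' a, F a b) (∑' a, ∑' b, F a b) := by
  have hs' : Summable fun x : β × α ↦ F x.2 x.1 := (Equiv.prodComm β α).summable_iff.mpr hs
  have h : Summable fun b ↦ ∑' a, F a b := hs'.prod
  rw [Summable.tsum_comm (f := fun b a ↦ F a b) hs']
  exact h.hasSum

lemma summable_mul_pow_div_factorial {α : Type*} {f g : α → ℝ} (hf : ∀ a, 0 ≤ f a)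
    (hg : ∀ a, 0 ≤ g a) (h : Summable fun a ↦ f a * Real.exp (g a)) :
    Summable fun x : α × ℕ ↦ f x.1 * (g x.1 ^ x.2 / x.2.factorial) := by
  refine (summable_prod_of_nonneg fun x ↦ ?_).mpr
    ⟨fun p ↦ (hasSum_exp_coeff (g p)).summable.mul_left (f p), ?_⟩
  · exact mul_nonneg (hf _) (div_nonneg (pow_nonneg (hg _) _) (Nat.cast_nonneg _))
  · refine h.congr fun p ↦ ?_
    dsimp only
    rw [tsum_mul_left, (hasSum_exp_coeff _).tsum_eq]

lemma hasSum_thetaGen {t : ℝ} (ht : 0 < t) (w : ℂ) :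
    HasSum (fun k : ℕ ↦ w ^ k * (theta k t / k.factorial)) (∑' p, thetaGenTerm t w p) := by
  have hs : Summable fun x : (ℤ × ℤ) × ℕ ↦ w ^ x.2 * (thetaTerm x.2 t x.1 / x.2.factorial) := by
    have hb := summable_mul_pow_div_factorial (fun p : ℤ × ℤ ↦ (Real.exp_pos _).le)
      (fun p ↦ by positivity) (summable_exp_normForm_add_norm ht ‖w‖)
    refine hb.of_norm_bounded fun x ↦ ?_
    rw [norm_mul, norm_div, norm_pow, Complex.norm_natCast, mul_pow]
    calc ‖w‖ ^ x.2 * (‖thetaTerm x.2 t x.1‖ / x.2.factorial) ≤ ‖w‖ ^ x.2 *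
          (Real.exp (-(2 * π / 7 * normForm x.1) * t) * ‖latticePt x.1‖ ^ x.2 / x.2.factorial) := by
          gcongr
          exact norm_thetaTerm_le _ _ _
      _ = _ := by ring
  have h := hasSum_tsum_comm (F := fun p k ↦ w ^ k * (thetaTerm k t p / k.factorial)) hs
  simp only [fun p ↦ (thetaGenTerm_hasSum t w p).tsum_eq, tsum_mul_left, tsum_div_const] at h
  exact h

/-- The root number in the functional equation of `theta k`. -/
noncomputable def rootNumber (k : ℕ) : ℂ := gauss7 / √7 * (I ^ k)⁻¹

lemma norm_rootNumber (k : ℕ) : ‖rootNumber k‖ = 1 := by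
  have : √7 ≠ 0 := by positivity
  rw [rootNumber, norm_mul, norm_div, norm_gauss7, norm_inv, norm_pow, norm_I, norm_real,
    Real.norm_of_nonneg (Real.sqrt_nonneg _)]
  simp [this]

/-- Compares coefficients of w^k in `thetaGen_functional_equation`; the substitution w ↦ Iw/t
contributes (I/t)^k. -/
lemma theta_functional_equation (k : ℕ) {t : ℝ} (ht : 0 < t) :
    theta k (1 / t) = rootNumber k * (t : ℂ) ^ (k + 1) * theta k t := by
  have htC : (t : ℂ) ≠ 0 := by exact_mod_cast ht.ne'
  have h7 : (√7 : ℂ) ≠ 0 := by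
    exact_mod_cast (Real.sqrt_pos.mpr (by norm_num : (0 : ℝ) < 7)).ne'
  have hI : I ^ k ≠ 0 := pow_ne_zero _ I_ne_zero
  have h := eq_of_forall_hasSum_pow_mul
    (a := fun k ↦ gauss7 * (theta k t / k.factorial))
    (b := fun k ↦ √7 / t * ((I / t) ^ k * (theta k (1 / t) / k.factorial)))
    (f := fun w ↦ gauss7 * ∑' p, thetaGenTerm t w p) (fun w ↦ by
      convert! (hasSum_thetaGen ht w).mul_left gauss7 using 1
      funext k; ring) (fun w ↦ by
      rw [thetaGen_functional_equation ht]
      convert! (hasSum_thetaGen (one_div_pos.mpr ht) (I * w / t)).mul_left (√7 / t : ℂ) using 1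
      funext k
      rw [div_pow, div_pow, mul_pow]; ring)
  have hk := congrFun h k
  have hf : (k.factorial : ℂ) ≠ 0 := by exact_mod_cast k.factorial_ne_zero
  rw [rootNumber]
  generalize theta k (1 / t) = A at *
  generalize theta k t = B at *
  field_simp at hk ⊢
  rw [div_pow] at hk
  field_simp at hk
  rw [mul_assoc, mul_assoc]
  linear_combination (-1 : ℂ) * hk

/-! ### Decay, Mellin transform and analytic continuation -/

lemma norm_thetaTerm_le_of_one_le {t : ℝ} (ht : 1 ≤ t) (k : ℕ) (p : ℤ × ℤ) : ‖thetaTerm k t p‖ ≤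
    Real.exp (-(π / 7) * t) * (Real.exp (-(2 * π / 7 * normForm p) * (1 / 2)) *
      ‖latticePt p‖ ^ k) := by
  rcases eq_or_ne p 0 with rfl | hp
  · rw [thetaTerm, eps_zero]; simp; positivity
  refine (norm_thetaTerm_le k t p).trans ?_
  rw [← mul_assoc, ← Real.exp_add]
  gcongr
  have : (1 : ℝ) ≤ normForm p := by exact_mod_cast normForm_pos hp
  -- Both t and the norm are at least 1, so half of the exponent yields decay in t and the other
  -- half keeps the series convergent.
  have h2 : t + normForm p ≤ 2 * normForm p * t := by nlinarith
  have := mul_le_mul_of_nonneg_left h2 (by positivity : 0 ≤ π / 7)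
  linarith

lemma continuousOn_theta (k : ℕ) : ContinuousOn (theta k) (Ioi 0) := by
  intro t ht
  have ht' : 0 < t / 2 := half_pos ht
  have h : ContinuousOn (theta k) (Ici (t / 2)) := by
    refine continuousOn_tsum (fun p ↦ ?_) (summable_exp_mul_norm_pow ht' k) fun p x hx ↦ ?_
    · unfold thetaTerm; fun_prop
    · refine (norm_thetaTerm_le k x p).trans ?_
      have := normForm_nonneg p
      have : (0 : ℝ) ≤ normForm p := by exact_mod_cast this
      have := mul_le_mul_of_nonneg_left (mem_Ici.mp hx)
        (by positivity : 0 ≤ 2 * π / 7 * normForm p)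
      gcongr ?_ * _
      rw [Real.exp_le_exp]
      linarith
  exact (h.continuousAt (Ici_mem_nhds (half_lt_self ht))).continuousWithinAt

lemma theta_isBigO (k : ℕ) (r : ℝ) : theta k =O[atTop] (· ^ r) := by
  refine Asymptotics.IsBigO.trans ?_ (isLittleO_exp_neg_mul_rpow_atTop
    (by positivity : 0 < π / 7) r).isBigO
  refine Asymptotics.IsBigO.of_bound (∑' p : ℤ × ℤ,
    Real.exp (-(2 * π / 7 * normForm p) * (1 / 2)) * ‖latticePt p‖ ^ k) ?_
  filter_upwards [eventually_ge_atTop 1] with t ht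
  have hs := summable_exp_mul_norm_pow (by norm_num : (0 : ℝ) < 1 / 2) k
  rw [Real.norm_of_nonneg (Real.exp_pos _).le, mul_comm, ← tsum_mul_left]
  exact tsum_of_norm_bounded (hs.mul_left _).hasSum (norm_thetaTerm_le_of_one_le ht k)

/-- The functional-equation pair attached to `theta k`. -/
noncomputable def thetaFEPair (k : ℕ) : WeakFEPair ℂ where
  f := theta k
  g := theta k
  k := k + 1
  ε := rootNumber k
  -- There is no constant term, since ψ vanishes at the origin; hence the pair is strong and its
  -- Mellin transform has no poles.
  f₀ := 0
  g₀ := 0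
  hf_int := (continuousOn_theta k).locallyIntegrableOn measurableSet_Ioi
  hg_int := (continuousOn_theta k).locallyIntegrableOn measurableSet_Ioi
  hk := by positivity
  hε := by
    rw [← norm_pos_iff, norm_rootNumber]; exact one_pos
  h_feq x hx := by
    rw [theta_functional_equation k hx, smul_eq_mul]
    norm_cast
  hf_top r := by simpa using theta_isBigO k r
  hg_top r := by simpa using theta_isBigO k r

lemma thetaFEPair_isStrong (k : ℕ) : IsStrongFEPair (thetaFEPair k) := ⟨rfl, rfl⟩

lemma differentiable_mellin_theta (k : ℕ) : Differentiable ℂ (mellin (theta k)) := by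
  have h := (thetaFEPair_isStrong k).differentiable_Λ
  rwa [(thetaFEPair_isStrong k).Λ_eq] at h

lemma mellinConvergent_theta (k : ℕ) (s : ℂ) : MellinConvergent (theta k) s :=
  ((thetaFEPair_isStrong k).hasMellin s).1

/-- The continuation of the Hecke series, as a Mellin transform of the theta series. -/
noncomputable def heckeMellin (k : ℕ) (s : ℂ) : ℂ :=
  1 / 2 * (((2 * π / 7 : ℝ) : ℂ) ^ (s + k / 2) * ((Gamma (s + k / 2))⁻¹ *
    mellin (theta k) (s + k / 2)))

lemma differentiable_heckeMellin (k : ℕ) : Differentiable ℂ (heckeMellin k) := by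
  have h0 : ((2 * π / 7 : ℝ) : ℂ) ≠ 0 := by
    exact_mod_cast (by positivity : (0 : ℝ) < 2 * π / 7).ne'
  have h1 : Differentiable ℂ fun s : ℂ ↦ s + k / 2 := by fun_prop
  refine Differentiable.const_mul (Differentiable.mul ?_ (Differentiable.mul ?_ ?_)) _
  · exact h1.const_cpow (Or.inl h0)
  · exact differentiable_one_div_Gamma.comp h1
  · exact (differentiable_mellin_theta k).comp h1

lemma summable_normForm_rpow {σ : ℝ} (hσ : 1 < σ) :
    Summable fun p : ℤ × ℤ ↦ (normForm p : ℝ) ^ (-σ) := by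
  have h := EisensteinSeries.summable_one_div_norm_rpow (k := 2 * σ) (by linarith)
  have h2 := (finTwoArrowEquiv ℤ).symm.summable_iff.mpr h
  refine Summable.of_nonneg_of_le (fun p ↦ ?_) (fun p ↦ ?_) (h2.mul_left (2 ^ σ))
  · have : (0 : ℝ) ≤ normForm p := by exact_mod_cast normForm_nonneg p
    positivity
  rcases eq_or_ne p 0 with rfl | hp
  · simp [normForm, Real.zero_rpow (by linarith : -σ ≠ 0)]
    positivity
  set x : Fin 2 → ℤ := (finTwoArrowEquiv ℤ).symm p with hx
  change _ ≤ 2 ^ σ * ‖x‖ ^ (-(2 * σ))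
  have hx0 : x ≠ 0 := by
    intro h0
    apply hp
    have := congrArg (finTwoArrowEquiv ℤ) h0
    simpa [hx, Prod.ext_iff] using this
  have hxpos : 0 < ‖x‖ := norm_pos_iff.mpr hx0
  have hle : ‖x‖ ^ 2 / 2 ≤ normForm p := by
    refine le_trans ?_ (half_sq_add_sq_le_normForm p)
    gcongr
    rw [EisensteinSeries.norm_eq_max_natAbs]
    have e0 : x 0 = p.1 := by simp [hx]
    have e1 : x 1 = p.2 := by simp [hx]
    rw [e0, e1]
    rcases max_choice p.1.natAbs p.2.natAbs with h | h <;> rw [h] <;>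
      simp [Nat.cast_natAbs, Int.cast_abs, sq_nonneg]
  calc (normForm p : ℝ) ^ (-σ) ≤ (‖x‖ ^ 2 / 2) ^ (-σ) :=
        Real.rpow_le_rpow_of_nonpos (by positivity) hle (by linarith)
    _ = 2 ^ σ * ‖x‖ ^ (-(2 * σ)) := by
        rw [Real.div_rpow (by positivity) (by norm_num), Real.rpow_neg (by norm_num : (0 : ℝ) ≤ 2),
          ← Real.rpow_natCast, ← Real.rpow_mul hxpos.le]
        push_cast
        rw [div_inv_eq_mul, mul_comm]
        congr 2
        ring

lemma thetaTerm_zero (k : ℕ) (t : ℝ) : thetaTerm k t 0 = 0 := by simp [thetaTerm, eps_zero]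

/-- Termwise Mellin transform, followed by division by the Gamma factor. The oddness of k enters
through ψ^k = ψ. -/
lemma hasSum_heckeTerm {k : ℕ} (hk : Odd k) {s : ℂ} (hs : 1 < s.re) :
    HasSum (fun p : {p : ℤ × ℤ // p ≠ 0} ↦ heckeTerm k s p) (heckeMellin k s) := by
  have hre : (s + k / 2).re = s.re + k / 2 := by
    rw [add_re, show (k / 2 : ℂ) = ((k / 2 : ℝ) : ℂ) by push_cast; ring, ofReal_re]
  have hs' : 0 < (s + k / 2).re := by rw [hre]; positivity
  have hpos (p : {p : ℤ × ℤ // p ≠ 0}) : (0 : ℝ) < normForm p := by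
    exact_mod_cast normForm_pos p.2
  have h := hasSum_mellin (ι := {p : ℤ × ℤ // p ≠ 0}) (s := s + k / 2) (F := theta k)
    (a := fun p ↦ eps p * latticePt p ^ k) (p := fun p ↦ 2 * π / 7 * normForm p)
    (fun p ↦ Or.inr (by have := hpos p; positivity)) hs' (fun t ht ↦ ?_) ?_
  · have h2 := h.mul_left (1 / 2 * (((2 * π / 7 : ℝ) : ℂ) ^ (s + k / 2) *
      (Gamma (s + k / 2))⁻¹))
    convert! h2 using 1
    · funext p
      have hΓ : Gamma (s + k / 2) ≠ 0 := Gamma_ne_zero_of_re_pos hs'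
      have hc : ((2 * π / 7 : ℝ) : ℂ) ^ (s + k / 2) ≠ 0 := by
        rw [Ne, cpow_eq_zero_iff, not_and_or]
        left
        exact_mod_cast (by positivity : (0 : ℝ) < 2 * π / 7).ne'
      rw [ofReal_mul, mul_cpow_ofReal_nonneg (by positivity) (hpos p).le, heckeTerm, heckeChi,
        mul_pow, ← Int.cast_pow, eps_pow_odd _ hk, ofReal_intCast]
      change 1 / 2 * ((eps p : ℂ) * latticePt p ^ k / _) = _
      generalize s + (k : ℂ) / 2 = z at hΓ hc ⊢
      field_simp
    · rw [heckeMellin]; ring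
  · have h1 := (summable_thetaTerm ht k).hasSum
    rw [← hasSum_subtype_iff_of_support_subset (s := {p | p ≠ 0})] at h1
    · exact h1
    · intro p hp h0
      rw [h0] at hp
      exact hp (thetaTerm_zero k t)
  · have h1 := ((summable_normForm_rpow hs).mul_left
      (((2 * π / 7) ^ (s.re + k / 2) : ℝ)⁻¹)).subtype {p | p ≠ 0}
    refine Summable.of_nonneg_of_le (fun p ↦ ?_) (fun p ↦ ?_) h1
    · have := hpos p; positivity
    · have hp := hpos p
      rw [hre, Real.mul_rpow (by positivity) hp.le, Real.rpow_add hp, norm_mul, norm_pow,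
        norm_latticePt]
      have e : √(normForm p : ℝ) ^ k = (normForm p : ℝ) ^ ((k : ℝ) / 2) := by
        rw [Real.sqrt_eq_rpow, ← Real.rpow_natCast, ← Real.rpow_mul hp.le]
        congr 1; ring
      rw [e]
      have h3 := norm_eps_le_one p
      simp only [Function.comp_apply]
      rw [Real.rpow_neg hp.le]
      have h5 : 0 < (normForm p : ℝ) ^ ((k : ℝ) / 2) := by positivity
      have h6 : 0 < (normForm p : ℝ) ^ s.re := by positivity
      have h7 : 0 < ((2 * π / 7) ^ (s.re + k / 2) : ℝ) := by positivity
      calc ‖(eps p : ℂ)‖ * (normForm p : ℝ) ^ ((k : ℝ) / 2) /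
          (((2 * π / 7) ^ (s.re + k / 2) : ℝ) * ((normForm p : ℝ) ^ s.re *
            (normForm p : ℝ) ^ ((k : ℝ) / 2))) ≤ 1 * (normForm p : ℝ) ^ ((k : ℝ) / 2) /
          (((2 * π / 7) ^ (s.re + k / 2) : ℝ) * ((normForm p : ℝ) ^ s.re *
            (normForm p : ℝ) ^ ((k : ℝ) / 2))) := by gcongr
        _ = _ := by field_simp

lemma isHeckeL_heckeMellin {k : ℕ} (hk : Odd k) : IsHeckeL k (heckeMellin k) :=
  ⟨differentiable_heckeMellin k, fun _ hs ↦ hasSum_heckeTerm hk hs⟩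

lemma IsHeckeL.eq {k : ℕ} {F G : ℂ → ℂ} (hF : IsHeckeL k F) (hG : IsHeckeL k G) : F = G := by
  have hFa : AnalyticOnNhd ℂ F univ := hF.1.differentiableOn.analyticOnNhd isOpen_univ
  have hGa : AnalyticOnNhd ℂ G univ := hG.1.differentiableOn.analyticOnNhd isOpen_univ
  refine hFa.eq_of_eventuallyEq hGa (z₀ := 2) ?_
  filter_upwards [(isOpen_lt continuous_const continuous_re).mem_nhds
    (show (1 : ℝ) < (2 : ℂ).re by norm_num)] with s hs
  exact (hF.2 s hs).unique (hG.2 s hs)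

lemma isHeckeL_heckeL {k : ℕ} (hk : Odd k) : IsHeckeL k (heckeL k) := by
  have h : ∃ F : ℂ → ℂ, IsHeckeL k F := ⟨_, isHeckeL_heckeMellin hk⟩
  rw [heckeL, dif_pos h]
  exact h.choose_spec

lemma heckeL_eq {k : ℕ} (hk : Odd k) : heckeL k = heckeMellin k :=
  (isHeckeL_heckeL hk).eq (isHeckeL_heckeMellin hk)

/-! ### Poisson tails -/

/-- The Poisson tail `exp (-y) ∑_{j < r} y ^ j / j!`, that is `Γ(r, y) / Γ(r)`. -/
noncomputable def poissonTail (r : ℕ) (y : ℝ) : ℝ :=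
  Real.exp (-y) * ∑ j ∈ Finset.range r, y ^ j / j.factorial

lemma poissonTail_nonneg (r : ℕ) {y : ℝ} (hy : 0 ≤ y) : 0 ≤ poissonTail r y :=
  mul_nonneg (Real.exp_pos _).le (Finset.sum_nonneg fun _ _ ↦ by positivity)

lemma poissonTail_le_one (r : ℕ) {y : ℝ} (hy : 0 ≤ y) : poissonTail r y ≤ 1 := by
  rw [poissonTail, Real.exp_neg, inv_mul_le_iff₀ (Real.exp_pos _), mul_one]
  exact Real.sum_le_exp_of_nonneg hy r

lemma poissonTail_mono {y : ℝ} (hy : 0 ≤ y) : Monotone fun r ↦ poissonTail r y := by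
  intro r s hrs
  refine mul_le_mul_of_nonneg_left ?_ (Real.exp_pos _).le
  exact Finset.sum_le_sum_of_subset_of_nonneg (Finset.range_mono hrs) fun _ _ _ ↦ by positivity

lemma poissonTail_le (r : ℕ) {y : ℝ} (hy : 0 ≤ y) :
    poissonTail r y ≤ 2 ^ r * Real.exp (-(y / 2)) := by
  have h : ∑ j ∈ Finset.range r, y ^ j / j.factorial ≤ 2 ^ r * Real.exp (y / 2) := by
    calc ∑ j ∈ Finset.range r, y ^ j / j.factorial
        ≤ ∑ j ∈ Finset.range r, 2 ^ r * ((y / 2) ^ j / j.factorial) := by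
          refine Finset.sum_le_sum fun j hj ↦ ?_
          have : (2 : ℝ) ^ j ≤ 2 ^ r :=
            pow_le_pow_right₀ (by norm_num) (Finset.mem_range.mp hj).le
          calc y ^ j / j.factorial = 2 ^ j * ((y / 2) ^ j / j.factorial) := by
                rw [div_pow]; field_simp
            _ ≤ _ := by gcongr
      _ ≤ _ := by
          rw [← Finset.mul_sum]
          gcongr
          exact Real.sum_le_exp_of_nonneg (by positivity) r
  calc poissonTail r y ≤ Real.exp (-y) * (2 ^ r * Real.exp (y / 2)) := by
        unfold poissonTail; gcongr
    _ = 2 ^ r * Real.exp (-(y / 2)) := by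
        rw [mul_left_comm, ← Real.exp_add]; congr 2; ring

/-- Follows from 2^r ≤ e^r ≤ e^(y/4) in `poissonTail_le`. -/
lemma poissonTail_le_of_le {r : ℕ} {y : ℝ} (hy : 4 * (r : ℝ) ≤ y) :
    poissonTail r y ≤ Real.exp (-(y / 4)) := by
  have hr : (0 : ℝ) ≤ r := r.cast_nonneg
  refine (poissonTail_le r (by linarith)).trans ?_
  have h2 : (2 : ℝ) ^ r ≤ Real.exp r := by
    rw [← Real.exp_one_pow r]
    gcongr
    linarith [Real.add_one_le_exp 1]
  calc (2 : ℝ) ^ r * Real.exp (-(y / 2)) ≤ Real.exp r * Real.exp (-(y / 2)) := by gcongr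
    _ ≤ _ := by rw [← Real.exp_add, Real.exp_le_exp]; linarith

/-- The derivatives of successive terms telescope, leaving only the last. -/
lemma hasDerivAt_poissonTail (r : ℕ) (y : ℝ) :
    HasDerivAt (poissonTail (r + 1)) (-(Real.exp (-y) * y ^ r / r.factorial)) y := by
  have he : HasDerivAt (fun y : ℝ ↦ Real.exp (-y)) (-Real.exp (-y)) y := by
    simpa using (hasDerivAt_neg y).exp
  induction r with
  | zero =>
    have h : poissonTail (0 + 1) = fun y ↦ Real.exp (-y) := by funext y; simp [poissonTail]
    rw [h]
    simpa using he
  | succ r ih =>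
    have h : poissonTail (r + 1 + 1) = fun y ↦ poissonTail (r + 1) y +
        Real.exp (-y) * (y ^ (r + 1) / (r + 1).factorial) := by
      funext y
      rw [poissonTail, Finset.sum_range_succ, mul_add, poissonTail]
    rw [h]
    have := ih.add (he.mul ((hasDerivAt_pow (r + 1) y).div_const ((r + 1).factorial : ℝ)))
    refine this.congr_deriv ?_
    rw [Nat.factorial_succ]
    push_cast
    have : ((r : ℝ) + 1) ≠ 0 := by positivity
    simp
    field_simp
    ring

lemma poissonTail_antitoneOn (r : ℕ) : AntitoneOn (poissonTail (r + 1)) (Ici 0) := by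
  refine antitoneOn_of_deriv_nonpos (convex_Ici 0)
    (fun y _ ↦ (hasDerivAt_poissonTail r y).continuousAt.continuousWithinAt)
    (fun y _ ↦ (hasDerivAt_poissonTail r y).differentiableAt.differentiableWithinAt) fun y hy ↦ ?_
  rw [interior_Ici, mem_Ioi] at hy
  rw [(hasDerivAt_poissonTail r y).deriv, neg_nonpos]
  positivity

lemma tendsto_poissonTail (r : ℕ) : Tendsto (poissonTail r) atTop (𝓝 0) := by
  have h : Tendsto (fun y : ℝ ↦ 2 ^ r * Real.exp (-(y / 2))) atTop (𝓝 0) := by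
    rw [← mul_zero ((2 : ℝ) ^ r)]
    refine Tendsto.const_mul _ (Real.tendsto_exp_neg_atTop_nhds_zero.comp ?_)
    exact tendsto_id.atTop_div_const (by norm_num)
  refine squeeze_zero' ?_ ?_ h
  · filter_upwards [eventually_ge_atTop 0] with y hy using poissonTail_nonneg r hy
  · filter_upwards [eventually_ge_atTop 0] with y hy using poissonTail_le r hy

lemma integral_Ioi_one_pow_mul_exp (m : ℕ) {x : ℝ} (hx : 0 < x) :
    IntegrableOn (fun t : ℝ ↦ t ^ m * Real.exp (-x * t)) (Ioi 1) ∧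
    ∫ t in Ioi (1 : ℝ), t ^ m * Real.exp (-x * t) =
      m.factorial / x ^ (m + 1) * poissonTail (m + 1) x := by
  have hd (t : ℝ) : HasDerivAt (fun t ↦ -(m.factorial / x ^ (m + 1)) * poissonTail (m + 1) (x * t))
      (t ^ m * Real.exp (-x * t)) t := by
    have h1 : HasDerivAt (fun t : ℝ ↦ x * t) x t := by simpa using (hasDerivAt_id t).const_mul x
    have := ((hasDerivAt_poissonTail m (x * t)).comp t h1).const_mul (-(m.factorial / x ^ (m + 1)))
    refine this.congr_deriv ?_
    rw [mul_pow, neg_mul x t]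
    field_simp
    ring
  have hpos : ∀ t ∈ Ioi (1 : ℝ), 0 ≤ t ^ m * Real.exp (-x * t) := fun t ht ↦ by
    have : (0 : ℝ) < t := one_pos.trans ht
    positivity
  have hlim : Tendsto (fun t ↦ -(m.factorial / x ^ (m + 1)) * poissonTail (m + 1) (x * t)) atTop
      (𝓝 0) := by
    rw [← mul_zero (-(m.factorial / x ^ (m + 1)) : ℝ)]
    exact ((tendsto_poissonTail _).comp (tendsto_id.const_mul_atTop hx)).const_mul _
  refine ⟨integrableOn_Ioi_deriv_of_nonneg' (fun t _ ↦ hd t) hpos hlim, ?_⟩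
  rw [integral_Ioi_of_hasDerivAt_of_nonneg' (fun t _ ↦ hd t) hpos hlim]
  simp

/-! ### The approximate functional equation at the centre -/

/-- The general term of the approximate functional equation at `1 / 2` of `L(s, χ ^ (2 m + 1))`. -/
noncomputable def centralTerm (m : ℕ) (p : ℤ × ℤ) : ℂ :=
  eps p * latticePt p ^ (2 * m + 1) / (normForm p : ℂ) ^ (m + 1) *
    (poissonTail (m + 1) (2 * π / 7 * normForm p) : ℂ)

lemma norm_coeff_le (m : ℕ) (p : ℤ × ℤ) :
    ‖(eps p : ℂ) * latticePt p ^ (2 * m + 1) / (normForm p : ℂ) ^ (m + 1)‖ ≤ ‖latticePt p‖⁻¹ := by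
  rcases eq_or_ne p 0 with rfl | hp
  · simp [eps_zero]
  have hN : (0 : ℝ) ≤ normForm p := by exact_mod_cast normForm_nonneg p
  have h1 := one_le_norm_latticePt hp
  have h2 : ‖(normForm p : ℂ)‖ = ‖latticePt p‖ ^ 2 := by
    rw [norm_latticePt_sq, norm_intCast, abs_of_nonneg hN]
  rw [norm_div, norm_mul, norm_pow, norm_pow, h2, ← pow_mul]
  have h3 := norm_eps_le_one p
  calc ‖(eps p : ℂ)‖ * ‖latticePt p‖ ^ (2 * m + 1) / ‖latticePt p‖ ^ (2 * (m + 1))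
      ≤ 1 * ‖latticePt p‖ ^ (2 * m + 1) / ‖latticePt p‖ ^ (2 * (m + 1)) := by gcongr
    _ = _ := by
      rw [show 2 * (m + 1) = 2 * m + 1 + 1 by ring, pow_succ ‖latticePt p‖ (2 * m + 1)]
      field_simp

lemma normForm_cast_nonneg (p : ℤ × ℤ) : (0 : ℝ) ≤ normForm p := by
  exact_mod_cast normForm_nonneg p

lemma norm_centralTerm_le (m : ℕ) (p : ℤ × ℤ) :
    ‖centralTerm m p‖ ≤ ‖latticePt p‖⁻¹ * poissonTail (m + 1) (2 * π / 7 * normForm p) := by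
  have hN := normForm_cast_nonneg p
  have hG := poissonTail_nonneg (m + 1) (by positivity : 0 ≤ 2 * π / 7 * (normForm p : ℝ))
  rw [centralTerm, norm_mul, norm_real, Real.norm_of_nonneg hG]
  exact mul_le_mul_of_nonneg_right (norm_coeff_le m p) hG

lemma summable_centralTerm (m : ℕ) : Summable (centralTerm m) := by
  refine ((summable_exp_mul_norm_pow (by norm_num : (0 : ℝ) < 1 / 2) 0).mul_left
    (2 ^ (m + 1))).of_norm_bounded fun p ↦ ?_
  have hN : (0 : ℝ) ≤ normForm p := by exact_mod_cast normForm_nonneg p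
  refine (norm_centralTerm_le m p).trans ?_
  have h1 : ‖latticePt p‖⁻¹ ≤ 1 := by
    rcases eq_or_ne p 0 with rfl | hp
    · simp [latticePt]
    · exact inv_le_one_of_one_le₀ (one_le_norm_latticePt hp)
  have hG := poissonTail_nonneg (m + 1) (by positivity : 0 ≤ 2 * π / 7 * normForm p)
  refine (mul_le_of_le_one_left hG h1).trans ((poissonTail_le _ (by positivity)).trans ?_)
  rw [pow_zero, mul_one]
  apply le_of_eq
  congr 2
  ring

lemma integral_Ioi_one_theta (m : ℕ) :
    ∫ t in Ioi (1 : ℝ), (t : ℂ) ^ m * theta (2 * m + 1) t =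
      m.factorial / (2 * π / 7 : ℝ) ^ (m + 1) * ∑' p, centralTerm m p := by
  have hx {p : ℤ × ℤ} (hp : p ≠ 0) : 0 < 2 * π / 7 * normForm p := by
    have : (0 : ℝ) < normForm p := by exact_mod_cast normForm_pos hp
    positivity
  have hform (p : ℤ × ℤ) (t : ℝ) : (t : ℂ) ^ m * thetaTerm (2 * m + 1) t p =
      (eps p * latticePt p ^ (2 * m + 1)) *
        ((t ^ m * Real.exp (-(2 * π / 7 * normForm p) * t) : ℝ) : ℂ) := by
    rw [thetaTerm]; push_cast; ring
  have hint (p : ℤ × ℤ) :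
      IntegrableOn (fun t : ℝ ↦ (t : ℂ) ^ m * thetaTerm (2 * m + 1) t p) (Ioi 1) := by
    simp only [hform]
    rcases eq_or_ne p 0 with rfl | hp
    · simp [eps_zero]
    · exact ((integral_Ioi_one_pow_mul_exp m (hx hp)).1.ofReal).const_mul _
  have hval (p : ℤ × ℤ) : ∫ t in Ioi (1 : ℝ), (t : ℂ) ^ m * thetaTerm (2 * m + 1) t p =
      m.factorial / (2 * π / 7 : ℝ) ^ (m + 1) * centralTerm m p := by
    simp only [hform]
    rcases eq_or_ne p 0 with rfl | hp
    · simp [centralTerm, eps_zero]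
    · rw [integral_const_mul, integral_complex_ofReal, (integral_Ioi_one_pow_mul_exp m (hx hp)).2,
        centralTerm]
      push_cast
      rw [mul_pow]
      field_simp
  have hnorm (p : ℤ × ℤ) : ∫ t in Ioi (1 : ℝ), ‖(t : ℂ) ^ m * thetaTerm (2 * m + 1) t p‖ =
      m.factorial / (2 * π / 7 : ℝ) ^ (m + 1) * ‖centralTerm m p‖ := by
    have h1 : ∫ t in Ioi (1 : ℝ), ‖(t : ℂ) ^ m * thetaTerm (2 * m + 1) t p‖ =
        ∫ t in Ioi (1 : ℝ), ‖(eps p * latticePt p ^ (2 * m + 1) : ℂ)‖ *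
          (t ^ m * Real.exp (-(2 * π / 7 * normForm p) * t)) := by
      refine setIntegral_congr_fun measurableSet_Ioi fun t ht ↦ ?_
      have : (0 : ℝ) < t := one_pos.trans ht
      simp only [hform]
      rw [norm_mul, norm_real, Real.norm_of_nonneg (by positivity)]
    rw [h1, integral_const_mul]
    rcases eq_or_ne p 0 with rfl | hp
    · simp [centralTerm, eps_zero]
    · have hN : (0 : ℝ) < normForm p := by exact_mod_cast normForm_pos hp
      rw [(integral_Ioi_one_pow_mul_exp m (hx hp)).2, centralTerm, norm_mul _ (poissonTail _ _ : ℂ), norm_div, norm_mul, norm_real,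
        Real.norm_of_nonneg (poissonTail_nonneg _ (hx hp).le), norm_pow (normForm p : ℂ),
        norm_intCast (normForm p), abs_of_pos hN, mul_pow]
      field_simp
  have h := hasSum_integral_of_summable_integral_norm hint (by
    simp only [hnorm]
    exact (summable_centralTerm m).norm.mul_left _)
  simp only [hval] at h
  rw [← tsum_mul_left, h.tsum_eq]
  refine setIntegral_congr_fun measurableSet_Ioi fun t _ ↦ ?_
  simp only [theta]
  rw [tsum_mul_left]

/-- Split at t = 1 and fold (0, 1) onto (1, ∞) by t ↦ 1/t. The weight is k + 1 = 2(m + 1), so m + 1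
is the centre of symmetry and both halves have the same integrand up to the root number. -/
lemma mellin_theta_center (m : ℕ) : mellin (theta (2 * m + 1)) (m + 1) =
    (1 + rootNumber (2 * m + 1)) * ∫ t in Ioi (1 : ℝ), (t : ℂ) ^ m * theta (2 * m + 1) t := by
  set k := 2 * m + 1
  set h : ℝ → ℂ := (Ioi 1).indicator (theta k) with hh
  have hconv := mellinConvergent_theta k (m + 1)
  have e1 : mellin h (m + 1) = ∫ t in Ioi (1 : ℝ), (t : ℂ) ^ m * theta k t := by
    have : ∀ t : ℝ, (t : ℂ) ^ ((m + 1 : ℂ) - 1) • h t =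
        (Ioi 1).indicator (fun t : ℝ ↦ (t : ℂ) ^ m * theta k t) t := by
      intro t
      rw [hh]
      by_cases ht : t ∈ Ioi (1 : ℝ)
      · rw [indicator_of_mem ht, indicator_of_mem ht, add_sub_cancel_right, cpow_natCast,
          smul_eq_mul]
      · rw [indicator_of_notMem ht, indicator_of_notMem ht, smul_zero]
    rw [mellin]
    simp only [this]
    rw [setIntegral_indicator measurableSet_Ioi]
    congr 2
    exact inter_eq_right.mpr (Ioi_subset_Ioi zero_le_one)
  have e2 : ∫ t in Ioc (0 : ℝ) 1, (t : ℂ) ^ m * theta k t = rootNumber k * mellin h (m + 1) := by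
    have e3 : mellin h (m + 1) = mellin (fun t ↦ h t⁻¹) (-(m + 1)) := by
      rw [mellin_comp_inv, neg_neg]
    rw [e3, mellin, ← integral_const_mul, integral_Ioc_eq_integral_Ioo,
      ← integral_indicator measurableSet_Ioo, ← integral_indicator measurableSet_Ioi]
    congr 1
    funext t
    by_cases ht : 0 < t
    · have htC : (t : ℂ) ≠ 0 := by exact_mod_cast ht.ne'
      rw [indicator_of_mem (mem_Ioi.mpr ht)]
      by_cases h1 : t < 1
      · rw [indicator_of_mem (mem_Ioo.mpr ⟨ht, h1⟩), hh, indicator_of_mem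
          (mem_Ioi.mpr ((one_lt_inv₀ ht).mpr h1)), smul_eq_mul]
        have hfe := theta_functional_equation k (inv_pos.mpr ht)
        rw [one_div, inv_inv] at hfe
        rw [hfe, show (-(m + 1 : ℂ) - 1) = -((m + 2 : ℕ) : ℂ) by push_cast; ring, cpow_neg,
          cpow_natCast, show k + 1 = m + (m + 2) by simp only [k]; ring]
        push_cast
        rw [pow_add, inv_pow, inv_pow]
        field_simp
      · rw [indicator_of_notMem (fun h2 ↦ h1 h2.2), hh, indicator_of_notMem, smul_zero, mul_zero]
        rw [mem_Ioi, not_lt]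
        exact inv_le_one_of_one_le₀ (not_lt.mp h1)
    · rw [indicator_of_notMem (fun h2 ↦ ht h2.1), indicator_of_notMem (s := Ioi 0) ht]
  have e4 : mellin (theta k) (m + 1) = ∫ t in Ioi (0 : ℝ), (t : ℂ) ^ m * theta k t := by
    rw [mellin]
    simp only [add_sub_cancel_right, cpow_natCast, smul_eq_mul]
  have hi : IntegrableOn (fun t : ℝ ↦ (t : ℂ) ^ m * theta k t) (Ioi 0) := by
    simpa only [MellinConvergent, add_sub_cancel_right, cpow_natCast, smul_eq_mul] using hconv
  rw [e4, ← Ioc_union_Ioi_eq_Ioi zero_le_one, setIntegral_union Ioc_disjoint_Ioi_same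
    measurableSet_Ioi (hi.mono_set Ioc_subset_Ioi_self) (hi.mono_set (Ioi_subset_Ioi zero_le_one)),
    e2, e1]
  ring

/-- The approximate functional equation at the central point. -/
lemma heckeL_center (m : ℕ) : heckeL (2 * m + 1) (1 / 2) =
    1 / 2 * (1 + rootNumber (2 * m + 1)) * ∑' p, centralTerm m p := by
  have hs : (1 / 2 + ((2 * m + 1 : ℕ) : ℂ) / 2) = m + 1 := by push_cast; ring
  have hc : ((2 * π / 7 : ℝ) : ℂ) ≠ 0 := by
    exact_mod_cast (by positivity : (0 : ℝ) < 2 * π / 7).ne'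
  have hf : (m.factorial : ℂ) ≠ 0 := by exact_mod_cast m.factorial_ne_zero
  rw [heckeL_eq ⟨m, rfl⟩, heckeMellin, hs, mellin_theta_center, integral_Ioi_one_theta,
    Gamma_nat_eq_factorial, show (m + 1 : ℂ) = ((m + 1 : ℕ) : ℂ) by push_cast; ring, cpow_natCast]
  field_simp

/-- Only the absolute value 1 of the root number is used, not its value. -/
lemma norm_heckeL_center_le (m : ℕ) :
    ‖heckeL (2 * m + 1) (1 / 2)‖ ≤ ‖∑' p, centralTerm m p‖ := by
  rw [heckeL_center, norm_mul]
  refine mul_le_of_le_one_left (norm_nonneg _) ?_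
  have := norm_add_le 1 (rootNumber (2 * m + 1))
  rw [norm_rootNumber, norm_one] at this
  rw [norm_mul, norm_div, norm_one, Complex.norm_two]
  linarith

/-! ### Lattice sums over boxes and counting by determinants -/

/-- The sup norm of a pair of integers. -/
def supNat (p : ℤ × ℤ) : ℕ := max p.1.natAbs p.2.natAbs

/-- The points of sup norm at most `R`. -/
noncomputable def latticeBox (R : ℕ) : Finset (ℤ × ℤ) := Finset.Icc (-R : ℤ) R ×ˢ Finset.Icc (-R : ℤ) R

/-- The nonzero points of sup norm at most `R`. -/
noncomputable def puncturedBox (R : ℕ) : Finset (ℤ × ℤ) := (latticeBox R).filter (· ≠ 0)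

lemma mem_latticeBox {R : ℕ} {p : ℤ × ℤ} : p ∈ latticeBox R ↔ supNat p ≤ R := by
  simp only [latticeBox, Finset.mem_product, Finset.mem_Icc, supNat]
  omega

lemma mem_puncturedBox {R : ℕ} {p : ℤ × ℤ} : p ∈ puncturedBox R ↔ supNat p ≤ R ∧ p ≠ 0 := by
  simp [puncturedBox, mem_latticeBox]

lemma supNat_pos {p : ℤ × ℤ} (hp : p ≠ 0) : 0 < supNat p := by
  rcases p with ⟨a, b⟩
  simp only [supNat]
  by_contra h
  exact hp (by ext <;> simp <;> omega)

lemma supNat_sq_le (p : ℤ × ℤ) : (supNat p : ℝ) ^ 2 / 2 ≤ normForm p := by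
  refine le_trans ?_ (half_sq_add_sq_le_normForm p)
  gcongr
  rw [supNat]
  rcases max_choice p.1.natAbs p.2.natAbs with h | h <;> rw [h] <;>
    simp [Nat.cast_natAbs, Int.cast_abs, sq_nonneg]

lemma supNat_le_two_mul_norm (p : ℤ × ℤ) : (supNat p : ℝ) ≤ 2 * ‖latticePt p‖ := by
  have h := supNat_sq_le p
  rw [← norm_latticePt_sq] at h
  refine abs_le_of_sq_le_sq' ?_ (by positivity) |>.2
  nlinarith [sq_nonneg ‖latticePt p‖]

lemma inv_norm_latticePt_le {p : ℤ × ℤ} (hp : p ≠ 0) :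
    ‖latticePt p‖⁻¹ ≤ 2 * (supNat p : ℝ)⁻¹ := by
  have h := supNat_le_two_mul_norm p
  have h1 : (0 : ℝ) < supNat p := by exact_mod_cast supNat_pos hp
  have h2 := one_le_norm_latticePt hp
  rw [← div_eq_mul_inv, le_div_iff₀ h1, inv_mul_le_iff₀ (by linarith)]
  linarith

/-- Exactly 8j lattice points have sup norm j ≥ 1. -/
lemma sum_puncturedBox (R : ℕ) (h : ℕ → ℝ) :
    ∑ p ∈ puncturedBox R, h (supNat p) = ∑ j ∈ Finset.Icc 1 R, 8 * j * h j := by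
  rw [← Finset.sum_fiberwise_of_maps_to (g := supNat) (t := Finset.Icc 1 R)]
  · refine Finset.sum_congr rfl fun j hj ↦ ?_
    obtain ⟨hj1, hjR⟩ := Finset.mem_Icc.mp hj
    have e : (puncturedBox R).filter (fun p ↦ supNat p = j) = Finset.box j := by
      ext p
      rw [Finset.mem_filter, mem_puncturedBox, Int.mem_box]
      constructor
      · exact fun h ↦ h.2
      · intro h1
        refine ⟨⟨h1.trans_le hjR, ?_⟩, h1⟩
        rintro rfl
        simp at h1
        omega
    rw [Finset.sum_congr e fun p hp ↦ by rw [show supNat p = j from Int.mem_box.mp hp],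
      Finset.sum_const, Int.card_box (by omega), nsmul_eq_mul]
    push_cast; ring
  · intro p hp
    obtain ⟨h1, h2⟩ := mem_puncturedBox.mp hp
    exact Finset.mem_Icc.mpr ⟨supNat_pos h2, h1⟩

lemma sum_Icc_inv_le (R : ℕ) : ∑ j ∈ Finset.Icc 1 R, (j : ℝ)⁻¹ ≤ 1 + Real.log R := by
  have := harmonic_le_one_add_log R
  rw [harmonic_eq_sum_Icc] at this
  push_cast at this
  exact this

lemma sum_puncturedBox_inv (R : ℕ) : ∑ p ∈ puncturedBox R, (supNat p : ℝ)⁻¹ = 8 * R := by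
  rw [sum_puncturedBox R fun j ↦ (j : ℝ)⁻¹]
  have : ∀ j ∈ Finset.Icc 1 R, 8 * (j : ℝ) * (j : ℝ)⁻¹ = 8 := fun j hj ↦ by
    have : (j : ℝ) ≠ 0 := by exact_mod_cast (by have := Finset.mem_Icc.mp hj; omega : j ≠ 0)
    field_simp
  rw [Finset.sum_congr rfl this]
  simp [mul_comm]

lemma sum_puncturedBox_inv_sq_le (R : ℕ) :
    ∑ p ∈ puncturedBox R, ((supNat p : ℝ) ^ 2)⁻¹ ≤ 8 * (1 + Real.log R) := by
  rw [sum_puncturedBox R fun j ↦ ((j : ℝ) ^ 2)⁻¹]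
  refine le_trans (le_of_eq ?_) (mul_le_mul_of_nonneg_left (sum_Icc_inv_le R) (by norm_num))
  rw [Finset.mul_sum]
  refine Finset.sum_congr rfl fun j hj ↦ ?_
  have : (j : ℝ) ≠ 0 := by exact_mod_cast (by have := Finset.mem_Icc.mp hj; omega : j ≠ 0)
  field_simp

lemma sum_norm_inv_le (R : ℕ) : ∑ p ∈ puncturedBox R, ‖latticePt p‖⁻¹ ≤ 16 * R := by
  calc ∑ p ∈ puncturedBox R, ‖latticePt p‖⁻¹
      ≤ ∑ p ∈ puncturedBox R, 2 * (supNat p : ℝ)⁻¹ :=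
        Finset.sum_le_sum fun p hp ↦ inv_norm_latticePt_le (mem_puncturedBox.mp hp).2
    _ = 16 * R := by rw [← Finset.mul_sum, sum_puncturedBox_inv]; ring

lemma sum_Icc_neg_inv_abs_le (V : ℕ) :
    ∑ v ∈ Finset.Icc (-V : ℤ) V, |(v : ℝ)|⁻¹ ≤ 2 * (1 + Real.log V) := by
  rw [← Finset.sum_fiberwise_of_maps_to (g := Int.natAbs) (t := Finset.Icc 0 V)]
  · rw [← Finset.add_sum_Ioc_eq_sum_Icc (Nat.zero_le V)]
    have h0 : ∑ v ∈ (Finset.Icc (-V : ℤ) V).filter (fun v ↦ v.natAbs = 0), |(v : ℝ)|⁻¹ = 0 := by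
      refine Finset.sum_eq_zero fun v hv ↦ ?_
      rw [Int.natAbs_eq_zero.mp (Finset.mem_filter.mp hv).2]
      simp
    rw [h0, zero_add]
    refine le_trans ?_ (mul_le_mul_of_nonneg_left (sum_Icc_inv_le V) (by norm_num))
    rw [Finset.mul_sum]
    refine Finset.sum_le_sum fun j _ ↦ ?_
    have hsub : (Finset.Icc (-V : ℤ) V).filter (fun v ↦ v.natAbs = j) ⊆ {(j : ℤ), -(j : ℤ)} := by
      intro v hv
      have := (Finset.mem_filter.mp hv).2
      simp only [Finset.mem_insert, Finset.mem_singleton]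
      omega
    refine (Finset.sum_le_sum_of_subset_of_nonneg hsub fun _ _ _ ↦ by positivity).trans ?_
    refine (Finset.sum_le_card_nsmul _ _ ((j : ℝ)⁻¹) fun v hv ↦ ?_).trans ?_
    · rcases Finset.mem_insert.mp hv with rfl | hv
      · simp
      · rw [Finset.mem_singleton.mp hv]; simp
    · rw [nsmul_eq_mul]
      gcongr
      exact_mod_cast Finset.card_le_two
  · intro v hv
    have := Finset.mem_Icc.mp hv
    exact Finset.mem_Icc.mpr ⟨Nat.zero_le _, by omega⟩

lemma card_le_of_dvd_sub {R r : ℕ} (hr : 0 < r) {T : Finset ℤ}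
    (hT : T ⊆ Finset.Icc (-R : ℤ) R) (hd : ∀ x ∈ T, ∀ y ∈ T, (r : ℤ) ∣ x - y) :
    (T.card : ℝ) ≤ (2 * R + 1) / r + 1 := by
  rcases T.eq_empty_or_nonempty with rfl | ⟨v, hv⟩
  · simp; positivity
  have hsub : T ⊆ (Finset.Ioc (-R - 1 : ℤ) R).filter (fun x ↦ x ≡ v [ZMOD r]) := by
    intro x hx
    have := Finset.mem_Icc.mp (hT hx)
    refine Finset.mem_filter.mpr ⟨Finset.mem_Ioc.mpr ⟨by omega, by omega⟩, ?_⟩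
    exact (Int.modEq_iff_dvd.mpr (hd v hv x hx))
  have h1 := Finset.card_le_card hsub
  have h2 := Int.Ioc_filter_modEq_card (-R - 1 : ℤ) R (r := r) (by exact_mod_cast hr) v
  have h3 : (T.card : ℤ) ≤ max (⌊((R : ℤ) - v : ℚ) / (r : ℤ)⌋ -
      ⌊(((-R - 1 : ℤ) : ℚ) - v) / (r : ℤ)⌋) 0 := by
    refine le_trans (Nat.cast_le.mpr h1) (le_of_eq ?_)
    exact_mod_cast h2
  have hrq : (0 : ℚ) < r := by exact_mod_cast hr
  have h4 : (T.card : ℚ) ≤ (2 * R + 1) / r + 1 := by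
    rcases le_max_iff.mp h3 with h | h
    · have h5 := Int.floor_le (((R : ℤ) - v : ℚ) / (r : ℤ))
      have h6 := Int.lt_floor_add_one ((((-R - 1 : ℤ) : ℚ) - v) / (r : ℤ))
      have h7 : (T.card : ℚ) ≤ ⌊((R : ℤ) - v : ℚ) / (r : ℤ)⌋ -
        ⌊(((-R - 1 : ℤ) : ℚ) - v) / (r : ℤ)⌋ := by exact_mod_cast h
      have h8 : ((R : ℤ) - v : ℚ) / (r : ℤ) - (((-R - 1 : ℤ) : ℚ) - v) / (r : ℤ) =
          (2 * R + 1) / r := by push_cast; field_simp; ring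
      linarith
    · have : (T.card : ℚ) ≤ 0 := by exact_mod_cast h
      exact this.trans (by positivity)
  have h5 := (Rat.cast_le (K := ℝ)).mpr h4
  push_cast at h5
  exact h5

/-- By coprimality the equation fixes q.1 modulo A and q.2 modulo B, and either coordinate
determines the other when its modulus is nonzero. The larger of |A| and |B| is taken as modulus. -/
lemma card_det_eq_le {R : ℕ} {A B : ℤ} (hAB : IsCoprime A B) (u : ℤ) :
    (((latticeBox R).filter fun q ↦ A * q.2 - B * q.1 = u).card : ℝ) ≤
      (2 * R + 1) / supNat (A, B) + 1 := by
  have hne : (A, B) ≠ 0 := by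
    rintro h
    obtain ⟨rfl, rfl⟩ := Prod.mk.inj h
    exact not_isCoprime_zero_zero hAB
  have hpos := supNat_pos hne
  set S := (latticeBox R).filter fun q ↦ A * q.2 - B * q.1 = u
  have hS {q : ℤ × ℤ} (hq : q ∈ S) : q.1 ∈ Finset.Icc (-R : ℤ) R ∧ q.2 ∈ Finset.Icc (-R : ℤ) R ∧
      A * q.2 - B * q.1 = u := by
    obtain ⟨h1, h2⟩ := Finset.mem_filter.mp hq
    exact ⟨(Finset.mem_product.mp h1).1, (Finset.mem_product.mp h1).2, h2⟩
  rcases max_choice A.natAbs B.natAbs with h | h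
  · have hs : supNat (A, B) = A.natAbs := h
    have hA : A ≠ 0 := by rintro rfl; rw [hs] at hpos; simp at hpos
    have hinj : Set.InjOn Prod.fst (S : Set (ℤ × ℤ)) := by
      intro q hq q' hq' he
      have h1 := (hS hq).2.2
      have h2 := (hS hq').2.2
      refine Prod.ext he (mul_left_cancel₀ hA ?_)
      rw [he] at h1
      linarith
    rw [← Finset.card_image_of_injOn hinj]
    refine card_le_of_dvd_sub hpos (fun x hx ↦ ?_) fun x hx y hy ↦ ?_
    · obtain ⟨q, hq, rfl⟩ := Finset.mem_image.mp hx
      exact (hS hq).1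
    · obtain ⟨q, hq, rfl⟩ := Finset.mem_image.mp hx
      obtain ⟨q', hq', rfl⟩ := Finset.mem_image.mp hy
      rw [hs, Int.natCast_natAbs, abs_dvd]
      refine hAB.dvd_of_dvd_mul_left ⟨q.2 - q'.2, ?_⟩
      linarith [(hS hq).2.2, (hS hq').2.2]
  · have hs : supNat (A, B) = B.natAbs := h
    have hB : B ≠ 0 := by rintro rfl; rw [hs] at hpos; simp at hpos
    have hinj : Set.InjOn Prod.snd (S : Set (ℤ × ℤ)) := by
      intro q hq q' hq' he
      have h1 := (hS hq).2.2
      have h2 := (hS hq').2.2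
      refine Prod.ext (mul_left_cancel₀ hB ?_) he
      rw [he] at h1
      linarith
    rw [← Finset.card_image_of_injOn hinj]
    refine card_le_of_dvd_sub hpos (fun x hx ↦ ?_) fun x hx y hy ↦ ?_
    · obtain ⟨q, hq, rfl⟩ := Finset.mem_image.mp hx
      exact (hS hq).2.1
    · obtain ⟨q, hq, rfl⟩ := Finset.mem_image.mp hx
      obtain ⟨q', hq', rfl⟩ := Finset.mem_image.mp hy
      rw [hs, Int.natCast_natAbs, abs_dvd]
      refine hAB.symm.dvd_of_dvd_mul_left ⟨q.1 - q'.1, ?_⟩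
      linarith [(hS hq).2.2, (hS hq').2.2]

/-- The sum of `1 / |det (p, q)|` over the `q` in a box with `det (p, q) ≠ 0`
(the other terms vanish by convention). -/
lemma sum_inv_det_le {R : ℕ} {p : ℤ × ℤ} (hp : p ≠ 0) (hpR : supNat p ≤ 5 * R) :
    ∑ q ∈ latticeBox R, |((p.1 * q.2 - p.2 * q.1 : ℤ) : ℝ)|⁻¹ ≤
      16 * R * (1 + Real.log (10 * R ^ 2)) * (supNat p : ℝ)⁻¹ := by
  have hR : 1 ≤ R := by have := supNat_pos hp; omega
  have hRr : (1 : ℝ) ≤ R := by exact_mod_cast hR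
  have hg : 0 < Int.gcd p.1 p.2 := by
    rw [Int.gcd_pos_iff]
    by_contra! h
    exact hp (Prod.ext h.1 h.2)
  -- Dividing p by its gcd g gives a coprime pair; the factor 1/g then recombines with 1/`supNat (A,
  -- B)` into 1/`supNat p`.
  obtain ⟨A, B, hAB, hA, hB⟩ := Int.exists_gcd_one hg
  set g := Int.gcd p.1 p.2
  have hcop : IsCoprime A B := Int.isCoprime_iff_gcd_eq_one.mpr hAB
  have hsup : supNat p = supNat (A, B) * g := by
    simp only [supNat, hA, hB, Int.natAbs_mul, Int.natAbs_natCast]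
    rw [max_mul_of_nonneg _ _ (Nat.zero_le _)]
  have hM : 0 < supNat (A, B) := by
    have := supNat_pos hp
    rw [hsup] at this
    exact Nat.pos_of_mul_pos_right this
  have hgr : (1 : ℝ) ≤ g := by exact_mod_cast hg
  have hMr : (0 : ℝ) < supNat (A, B) := by exact_mod_cast hM
  have hMA : |A| ≤ supNat (A, B) := by
    rw [Int.abs_eq_natAbs]; simp only [supNat]; omega
  have hMB : |B| ≤ supNat (A, B) := by
    rw [Int.abs_eq_natAbs]; simp only [supNat]; omega
  have hMR : supNat (A, B) ≤ 5 * R := by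
    rw [hsup] at hpR
    exact (Nat.le_mul_of_pos_right _ hg).trans hpR
  -- The bound 5R, rather than R, leaves room for `mulSqrt p`; the determinant is then at most 2 ·
  -- 5R · R. Its value 0 contributes 0, as `0⁻¹ = 0`.
  have hmaps : ∀ q ∈ latticeBox R, A * q.2 - B * q.1 ∈
      Finset.Icc (-(10 * R ^ 2 : ℕ) : ℤ) (10 * R ^ 2 : ℕ) := by
    intro q hq
    obtain ⟨h1, h2⟩ := Finset.mem_product.mp hq
    have h1 := abs_le.mpr (Finset.mem_Icc.mp h1)
    have h2 := abs_le.mpr (Finset.mem_Icc.mp h2)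
    rw [Finset.mem_Icc, ← abs_le]
    have hA5 : |A| ≤ 5 * R := hMA.trans (by exact_mod_cast hMR)
    have hB5 : |B| ≤ 5 * R := hMB.trans (by exact_mod_cast hMR)
    calc |A * q.2 - B * q.1| ≤ |A * q.2| + |B * q.1| := abs_sub _ _
      _ = |A| * |q.2| + |B| * |q.1| := by rw [abs_mul, abs_mul]
      _ ≤ 5 * R * R + 5 * R * R := by gcongr
      _ = _ := by push_cast; ring
  have hcount (u : ℤ) := card_det_eq_le (R := R) hcop u
  have hlog : 0 ≤ 1 + Real.log (10 * R ^ 2) := by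
    have := Real.log_nonneg (show (1 : ℝ) ≤ 10 * R ^ 2 by nlinarith)
    linarith
  calc ∑ q ∈ latticeBox R, |((p.1 * q.2 - p.2 * q.1 : ℤ) : ℝ)|⁻¹
      = (g : ℝ)⁻¹ * ∑ q ∈ latticeBox R, |((A * q.2 - B * q.1 : ℤ) : ℝ)|⁻¹ := by
        rw [Finset.mul_sum]
        refine Finset.sum_congr rfl fun q _ ↦ ?_
        rw [← mul_inv]
        congr 1
        rw [hA, hB, show A * (g : ℤ) * q.2 - B * (g : ℤ) * q.1 = g * (A * q.2 - B * q.1) by ring]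
        push_cast
        rw [abs_mul, abs_of_nonneg (by positivity : (0 : ℝ) ≤ g)]
    _ = (g : ℝ)⁻¹ * ∑ u ∈ Finset.Icc (-(10 * R ^ 2 : ℕ) : ℤ) (10 * R ^ 2 : ℕ),
          (((latticeBox R).filter fun q ↦ A * q.2 - B * q.1 = u).card : ℝ) * |(u : ℝ)|⁻¹ := by
        rw [← Finset.sum_fiberwise_of_maps_to hmaps]
        congr 1
        refine Finset.sum_congr rfl fun u _ ↦ ?_
        rw [Finset.sum_congr rfl fun q hq ↦ by rw [(Finset.mem_filter.mp hq).2],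
          Finset.sum_const, nsmul_eq_mul]
    _ ≤ (g : ℝ)⁻¹ * ∑ u ∈ Finset.Icc (-(10 * R ^ 2 : ℕ) : ℤ) (10 * R ^ 2 : ℕ),
          ((2 * R + 1) / supNat (A, B) + 1) * |(u : ℝ)|⁻¹ := by
        gcongr with u hu
        exact hcount u
    _ ≤ (g : ℝ)⁻¹ * (((2 * R + 1) / supNat (A, B) + 1) * (2 * (1 + Real.log (10 * R ^ 2)))) := by
        rw [← Finset.mul_sum]
        gcongr
        have := sum_Icc_neg_inv_abs_le (10 * R ^ 2)
        push_cast at this ⊢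
        exact this
    _ ≤ (g : ℝ)⁻¹ * (8 * R / supNat (A, B) * (2 * (1 + Real.log (10 * R ^ 2)))) := by
        gcongr
        rw [div_add_one hMr.ne']
        gcongr
        have : (supNat (A, B) : ℝ) ≤ 5 * R := by exact_mod_cast hMR
        linarith
    _ = _ := by
        rw [hsup]
        push_cast
        field_simp
        ring

/-- With p = g • b and b primitive, the summand is 1/(g N(b)). Dropping primitivity of b bounds the
sum by a product of two sums, each O(log R). -/
lemma sum_gcd_div_normForm_le (R : ℕ) :
    ∑ p ∈ puncturedBox R, (Int.gcd p.1 p.2 : ℝ) / normForm p ≤ 16 * (1 + Real.log R) ^ 2 := by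
  have hgcd {p : ℤ × ℤ} (hp : p ≠ 0) : 0 < Int.gcd p.1 p.2 := by
    rw [Int.gcd_pos_iff]
    by_contra! h
    exact hp (Prod.ext h.1 h.2)
  let φ : ℤ × ℤ → ℕ × (ℤ × ℤ) := fun p ↦
    (Int.gcd p.1 p.2, (p.1 / Int.gcd p.1 p.2, p.2 / Int.gcd p.1 p.2))
  have hφ (p : ℤ × ℤ) : p = ((φ p).1 : ℤ) • (φ p).2 := by
    refine Prod.ext ?_ ?_
    · exact (Int.mul_ediv_cancel' (Int.gcd_dvd_left _ _)).symm
    · exact (Int.mul_ediv_cancel' (Int.gcd_dvd_right _ _)).symm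
  have hinj : Function.Injective φ := fun p q h ↦ by rw [hφ p, hφ q, h]
  let G : ℕ × (ℤ × ℤ) → ℝ := fun x ↦ (x.1 : ℝ)⁻¹ * (2 * ((supNat x.2 : ℝ) ^ 2)⁻¹)
  have hsup (g : ℕ) (p : ℤ × ℤ) : supNat ((g : ℤ) • p) = g * supNat p := by
    simp only [supNat, Prod.smul_fst, Prod.smul_snd, smul_eq_mul, Int.natAbs_mul,
      Int.natAbs_natCast]
    rw [mul_max_of_nonneg _ _ (Nat.zero_le _)]
  have hmem : ∀ p ∈ puncturedBox R, φ p ∈ Finset.Icc 1 R ×ˢ puncturedBox R := by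
    intro p hp
    obtain ⟨h1, h2⟩ := mem_puncturedBox.mp hp
    have hg : 0 < (φ p).1 := hgcd h2
    have h3 : (φ p).2 ≠ 0 := by
      intro h; apply h2; rw [hφ p, h, smul_zero]
    have h4 := supNat_pos h3
    rw [hφ p, hsup] at h1
    refine Finset.mem_product.mpr ⟨Finset.mem_Icc.mpr ⟨hg, ?_⟩, mem_puncturedBox.mpr ⟨?_, h3⟩⟩
    · exact (Nat.le_mul_of_pos_right _ h4).trans h1
    · exact (Nat.le_mul_of_pos_left _ hg).trans h1
  calc ∑ p ∈ puncturedBox R, (Int.gcd p.1 p.2 : ℝ) / normForm p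
      ≤ ∑ p ∈ puncturedBox R, G (φ p) := by
        refine Finset.sum_le_sum fun p hp ↦ ?_
        have h2 := (mem_puncturedBox.mp hp).2
        have hg : (0 : ℝ) < (φ p).1 := by exact_mod_cast hgcd h2
        have h3 : (φ p).2 ≠ 0 := by
          intro h; apply h2; rw [hφ p, h, smul_zero]
        have h4 : (0 : ℝ) < supNat (φ p).2 := by exact_mod_cast supNat_pos h3
        have h5 : (normForm p : ℝ) = ((φ p).1 : ℝ) ^ 2 * normForm (φ p).2 := by
          conv_lhs => rw [hφ p]
          rw [normForm_smul]; push_cast; ring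
        have h6 := supNat_sq_le (φ p).2
        have h7 : (0 : ℝ) < normForm (φ p).2 := lt_of_lt_of_le (by positivity) h6
        change ((φ p).1 : ℝ) / normForm p ≤ _
        rw [h5]
        simp only [G]
        calc ((φ p).1 : ℝ) / (((φ p).1 : ℝ) ^ 2 * normForm (φ p).2) =
            ((φ p).1 : ℝ)⁻¹ * (normForm (φ p).2 : ℝ)⁻¹ := by field_simp
          _ ≤ ((φ p).1 : ℝ)⁻¹ * ((supNat (φ p).2 : ℝ) ^ 2 / 2)⁻¹ := by gcongr
          _ = _ := by rw [inv_div]; ring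
    _ = ∑ x ∈ (puncturedBox R).image φ, G x := (Finset.sum_image hinj.injOn).symm
    _ ≤ ∑ x ∈ Finset.Icc 1 R ×ˢ puncturedBox R, G x := by
        refine Finset.sum_le_sum_of_subset_of_nonneg (Finset.image_subset_iff.mpr hmem)
          fun x _ _ ↦ by positivity
    _ = (∑ j ∈ Finset.Icc 1 R, (j : ℝ)⁻¹) *
          (2 * ∑ p ∈ puncturedBox R, ((supNat p : ℝ) ^ 2)⁻¹) := by
        rw [Finset.mul_sum, Finset.sum_mul_sum, Finset.sum_product]
    _ ≤ (1 + Real.log R) * (2 * (8 * (1 + Real.log R))) := by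
        have : 0 ≤ Real.log R := Real.log_natCast_nonneg R
        gcongr
        · exact sum_Icc_inv_le R
        · exact sum_puncturedBox_inv_sq_le R
    _ = _ := by ring

/-! ### Partial summation, character sums and parallel pairs -/

lemma norm_sum_antitone_mul_le {f : ℕ → ℝ} (hf : Antitone f) (hf0 : ∀ n, 0 ≤ f n) {a : ℕ → ℂ}
    {B : ℝ} (ha : ∀ n, ‖∑ i ∈ Finset.range n, a i‖ ≤ B) (n : ℕ) :
    ‖∑ i ∈ Finset.range n, (f i : ℂ) * a i‖ ≤ B * f 0 := by
  have h := Finset.sum_range_by_parts f a n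
  simp only [real_smul] at h
  rw [h]
  refine (norm_sub_le _ _).trans ?_
  have h1 : ‖(f (n - 1) : ℂ) * ∑ i ∈ Finset.range n, a i‖ ≤ f (n - 1) * B := by
    rw [norm_mul, norm_real, Real.norm_of_nonneg (hf0 _)]
    exact mul_le_mul_of_nonneg_left (ha n) (hf0 _)
  have h2 : ‖∑ i ∈ Finset.range (n - 1), ((f (i + 1) - f i : ℝ) : ℂ) *
      ∑ i ∈ Finset.range (i + 1), a i‖ ≤ ∑ i ∈ Finset.range (n - 1), (f i - f (i + 1)) * B := by
    refine norm_sum_le_of_le _ fun i _ ↦ ?_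
    have : f (i + 1) ≤ f i := hf (Nat.le_succ i)
    rw [norm_mul, norm_real, Real.norm_of_nonpos (by linarith), neg_sub]
    exact mul_le_mul_of_nonneg_left (ha _) (by linarith)
  rw [← Finset.sum_mul, Finset.sum_range_sub'] at h2
  linarith

/-- Abel summation applied to the decreasing weight 1 - f. -/
lemma norm_sum_monotone_mul_le {f : ℕ → ℝ} (hf : Monotone f) (hf0 : ∀ n, 0 ≤ f n)
    (hf1 : ∀ n, f n ≤ 1) {a : ℕ → ℂ} {B : ℝ} (ha : ∀ n, ‖∑ i ∈ Finset.range n, a i‖ ≤ B) (n : ℕ) :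
    ‖∑ i ∈ Finset.range n, (f i : ℂ) * a i‖ ≤ 2 * B := by
  have hB : 0 ≤ B := (norm_nonneg _).trans (ha 0)
  have h := norm_sum_antitone_mul_le (f := fun i ↦ 1 - f i)
    (fun i j hij ↦ by have := hf hij; simp only; linarith) (fun n ↦ by linarith [hf1 n]) ha n
  have e : ∑ i ∈ Finset.range n, (f i : ℂ) * a i = ∑ i ∈ Finset.range n, a i -
      ∑ i ∈ Finset.range n, ((1 - f i : ℝ) : ℂ) * a i := by
    rw [← Finset.sum_sub_distrib]
    refine Finset.sum_congr rfl fun i _ ↦ ?_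
    push_cast; ring
  rw [e]
  refine (norm_sub_le _ _).trans ?_
  nlinarith [ha n, hf0 0, mul_nonneg hB (hf0 0)]

lemma norm_quad7_le_one (m : ℤ) : ‖quad7 m‖ ≤ 1 := by
  rw [quad7, quadraticChar_seven]; split_ifs <;> simp

lemma sum_quad7_period (n : ℕ) : ∑ i ∈ Finset.range 7, quad7 ((n + i : ℕ) + 1) = 0 := by
  simp only [Finset.sum_range_succ, Finset.sum_range_zero, quad7]
  push_cast
  generalize (n : ZMod 7) = c
  norm_cast
  revert c
  decide

lemma norm_sum_quad7_le (n : ℕ) : ‖∑ i ∈ Finset.range n, quad7 ((i : ℕ) + 1)‖ ≤ 7 := by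
  induction n using Nat.strong_induction_on with
  | _ n ih =>
    rcases lt_or_ge n 7 with h | h
    · refine (norm_sum_le_of_le _ fun i _ ↦ norm_quad7_le_one _).trans ?_
      simp only [Finset.sum_const, Finset.card_range, nsmul_eq_mul, mul_one]
      exact_mod_cast h.le
    · obtain ⟨m, rfl⟩ := Nat.exists_eq_add_of_le' h
      rw [Finset.sum_range_add, sum_quad7_period, add_zero]
      exact ih m (by omega)

lemma norm_centralTerm_le_inv (m : ℕ) (p : ℤ × ℤ) : ‖centralTerm m p‖ ≤ ‖latticePt p‖⁻¹ := by
  have h0 := normForm_cast_nonneg p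
  exact (norm_centralTerm_le m p).trans
    (mul_le_of_le_one_right (by positivity) (poissonTail_le_one _ (by positivity)))

lemma centralTerm_smul (m : ℕ) {j : ℤ} (hj : j ≠ 0) (p : ℤ × ℤ) : centralTerm m (j • p) =
    ((poissonTail (m + 1) (2 * π / 7 * (j ^ 2 * normForm p)) : ℂ) / j * quad7 j) *
      (eps p * latticePt p ^ (2 * m + 1) / (normForm p : ℂ) ^ (m + 1)) := by
  have hjC : (j : ℂ) ≠ 0 := by exact_mod_cast hj
  rw [centralTerm, eps_smul, latticePt_smul, normForm_smul, quad7]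
  push_cast
  rw [mul_pow, mul_pow, ← pow_mul, show 2 * (m + 1) = 2 * m + 1 + 1 by ring, pow_succ (j : ℂ)]
  field_simp
  ring

/-- Two signs cancel: -1 is a nonresidue modulo 7, and the power of α is odd. -/
lemma centralTerm_neg (m : ℕ) (p : ℤ × ℤ) : centralTerm m (-p) = centralTerm m p := by
  have h := centralTerm_smul m (j := -1) (by norm_num) p
  have h1 := centralTerm_smul m (j := 1) (by norm_num) p
  have hq : quad7 (-1) = -1 := by
    rw [show (-1 : ℤ) = 6 + 7 * (-1) by norm_num, quad7_add]; exact quad7_values.2.2.2.2.2.2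
  have hq1 : quad7 1 = 1 := quad7_values.2.1
  rw [one_smul] at h1
  rw [show -p = (-1 : ℤ) • p by simp, h, h1, hq, hq1]
  push_cast
  norm_num
  ring

lemma sum_Icc_neg_even {f : ℤ → ℂ} (hf : ∀ j, f (-j) = f j) (M : ℕ) :
    ∑ j ∈ (Finset.Icc (-M : ℤ) M).filter (· ≠ 0), f j = 2 * ∑ i ∈ Finset.range M, f (i + 1) := by
  induction M with
  | zero => simp [Finset.filter_singleton]
  | succ M ih =>
    have e : (Finset.Icc (-(M + 1 : ℕ) : ℤ) (M + 1 : ℕ)).filter (· ≠ 0) =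
        insert ((M : ℤ) + 1) (insert (-((M : ℤ) + 1)) ((Finset.Icc (-M : ℤ) M).filter (· ≠ 0))) := by
      ext j
      simp only [Finset.mem_filter, Finset.mem_Icc, Finset.mem_insert]
      push_cast
      omega
    rw [e, Finset.sum_insert, Finset.sum_insert, ih, Finset.sum_range_succ, hf]
    · ring
    · simp only [Finset.mem_filter, Finset.mem_Icc]; omega
    · simp only [Finset.mem_filter, Finset.mem_Icc, Finset.mem_insert]; omega

/-- The determinant of two pairs of integers. -/
def pairDet (p q : ℤ × ℤ) : ℤ := p.1 * q.2 - p.2 * q.1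

/-- The q parallel to p are the multiples j • b of a primitive b, and their terms are `quad7 j`
times a weight decreasing in |j|. Abel summation against character sums bounded by 7, doubled for
±j, gives 14. Estimating by absolute values would cost another logarithm. -/
lemma norm_sum_parallel_le (m R : ℕ) {p : ℤ × ℤ} (hp : p ≠ 0) :
    ‖∑ q ∈ (puncturedBox R).filter (fun q ↦ pairDet p q = 0), centralTerm m q‖ ≤
      14 * (Int.gcd p.1 p.2 : ℝ) * ‖latticePt p‖⁻¹ := by
  have hg : 0 < Int.gcd p.1 p.2 := by
    rw [Int.gcd_pos_iff]
    by_contra! h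
    exact hp (Prod.ext h.1 h.2)
  obtain ⟨A, B, hAB, hA, hB⟩ := Int.exists_gcd_one hg
  set g := Int.gcd p.1 p.2
  have hcop : IsCoprime A B := Int.isCoprime_iff_gcd_eq_one.mpr hAB
  set b : ℤ × ℤ := (A, B) with hb
  have hpb : p = (g : ℤ) • b := Prod.ext (by simp [hb, hA, mul_comm]) (by simp [hb, hB, mul_comm])
  have hb0 : b ≠ 0 := by rintro h; rw [h, smul_zero] at hpb; exact hp hpb
  have hsb := supNat_pos hb0
  have hsup (j : ℤ) : supNat (j • b) = j.natAbs * supNat b := by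
    simp only [supNat, Prod.smul_fst, Prod.smul_snd, smul_eq_mul, Int.natAbs_mul]
    rw [mul_max_of_nonneg _ _ (Nat.zero_le _)]
  have hset : (puncturedBox R).filter (fun q ↦ pairDet p q = 0) =
      ((Finset.Icc (-(R / supNat b : ℕ) : ℤ) (R / supNat b : ℕ)).filter (· ≠ 0)).image
        (fun j : ℤ ↦ j • b) := by
    ext q
    simp only [Finset.mem_filter, Finset.mem_image, mem_puncturedBox, Finset.mem_Icc]
    constructor
    · rintro ⟨⟨h1, h2⟩, h3⟩
      have h4 : A * q.2 = B * q.1 := by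
        have hg0 : (g : ℤ) ≠ 0 := by exact_mod_cast hg.ne'
        apply mul_left_cancel₀ hg0
        simp only [pairDet, hA, hB] at h3
        linarith
      obtain ⟨u, v, huv⟩ := hcop
      -- A Bézout relation for (A, B) recovers the coordinate of q along b.
      have e : q = (u * q.1 + v * q.2) • b := by
        refine Prod.ext ?_ ?_
        · simp only [hb, Prod.smul_fst, smul_eq_mul]
          linear_combination (-q.1) * huv + (-v) * h4
        · simp only [hb, Prod.smul_snd, smul_eq_mul]
          linear_combination (-q.2) * huv + u * h4
      refine ⟨u * q.1 + v * q.2, ⟨?_, ?_⟩, e.symm⟩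
      · rw [e, hsup] at h1
        have := (Nat.le_div_iff_mul_le hsb).mpr h1
        omega
      · intro h
        rw [h, zero_smul] at e
        exact h2 e
    · rintro ⟨j, ⟨h1, h2⟩, rfl⟩
      refine ⟨⟨?_, smul_ne_zero h2 hb0⟩, ?_⟩
      · rw [hsup]
        exact (Nat.le_div_iff_mul_le hsb).mp (by omega)
      · simp only [pairDet, hA, hB, hb, Prod.smul_fst, Prod.smul_snd, smul_eq_mul]
        ring
  have hinj : Function.Injective fun j : ℤ ↦ j • b := smul_left_injective ℤ hb0
  set X : ℂ := eps b * latticePt b ^ (2 * m + 1) / (normForm b : ℂ) ^ (m + 1) with hX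
  have hN := normForm_cast_nonneg b
  set f : ℕ → ℝ := fun i ↦
    poissonTail (m + 1) (2 * π / 7 * (((i : ℝ) + 1) ^ 2 * normForm b)) / (i + 1) with hf
  have hf0 (i : ℕ) : 0 ≤ f i := div_nonneg (poissonTail_nonneg _ (by positivity)) (by positivity)
  have hfa : Antitone f := by
    intro i j hij
    have hij' : (i : ℝ) ≤ j := by exact_mod_cast hij
    refine div_le_div₀ (poissonTail_nonneg _ (by positivity)) ?_ (by positivity) (by linarith)
    refine poissonTail_antitoneOn m (mem_Ici.mpr (by positivity)) (mem_Ici.mpr (by positivity)) ?_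
    gcongr
  have hf1 : f 0 ≤ 1 := by
    simp only [hf, Nat.cast_zero, zero_add, div_one]
    exact poissonTail_le_one _ (by positivity)
  have hterm (i : ℕ) : centralTerm m (((i : ℤ) + 1) • b) = (f i : ℂ) * quad7 ((i : ℕ) + 1) * X := by
    rw [centralTerm_smul m (by omega) b]
    simp only [hf]
    push_cast
    rfl
  rw [hset, Finset.sum_image hinj.injOn, sum_Icc_neg_even (f := fun j ↦ centralTerm m (j • b))
    (fun j ↦ by rw [neg_smul, centralTerm_neg])]
  simp only [hterm]
  rw [← Finset.sum_mul, norm_mul, norm_mul, Complex.norm_two]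
  have h1 := norm_sum_antitone_mul_le hfa hf0 norm_sum_quad7_le (R / supNat b)
  have h2 : ‖X‖ ≤ ‖latticePt b‖⁻¹ := norm_coeff_le m b
  have h3 : ‖latticePt b‖⁻¹ = g * ‖latticePt p‖⁻¹ := by
    rw [hpb, latticePt_smul, norm_mul]
    have : (g : ℝ) ≠ 0 := by exact_mod_cast hg.ne'
    simp
    field_simp
  calc 2 * (‖∑ i ∈ Finset.range (R / supNat b), (f i : ℂ) * quad7 ((i : ℕ) + 1)‖ * ‖X‖)
      ≤ 2 * (7 * ‖latticePt b‖⁻¹) := by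
        gcongr
        linarith
    _ = _ := by rw [h3]; ring

/-! ### Non-parallel pairs: geometric sums over n -/

lemma inv_norm_mul_inv_norm_one_sub_le {D : ℂ} (hr : D.re ≠ 0) (hi : D.im ≠ 0) :
    1 - D ^ 4 / (normSq D : ℂ) ^ 2 ≠ 0 ∧
      ‖D‖⁻¹ * (4 / ‖1 - D ^ 4 / (normSq D : ℂ) ^ 2‖) ≤ |D.im|⁻¹ + |D.re|⁻¹ := by
  have hD : D ≠ 0 := by rintro rfl; simp at hr
  have hn : 0 < ‖D‖ := norm_pos_iff.mpr hD
  have hs : (normSq D : ℂ) ≠ 0 := by exact_mod_cast (normSq_pos.mpr hD).ne'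
  have hra : 0 < |D.re| := abs_pos.mpr hr
  have hia : 0 < |D.im| := abs_pos.mpr hi
  -- As |D|⁴ = D²D̄², the difference |D|⁴ - D⁴ factors as D²(D̄ - D)(D̄ + D): the distance of the
  -- ratio from 1 is governed by the imaginary and real parts of D.
  have e1 : 1 - D ^ 4 / (normSq D : ℂ) ^ 2 =
      D ^ 2 * ((starRingEnd ℂ D - D) * (starRingEnd ℂ D + D)) / (normSq D : ℂ) ^ 2 := by
    rw [eq_div_iff (pow_ne_zero 2 hs), sub_mul, div_mul_cancel₀ _ (pow_ne_zero 2 hs),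
      normSq_eq_conj_mul_self]
    ring
  have e2 : ‖starRingEnd ℂ D - D‖ = 2 * |D.im| := by
    rw [← norm_neg, neg_sub, sub_conj, norm_mul, norm_I, mul_one, norm_real, Real.norm_eq_abs,
      abs_mul, abs_two]
  have e3 : ‖starRingEnd ℂ D + D‖ = 2 * |D.re| := by
    rw [add_comm, add_conj, norm_real, Real.norm_eq_abs, abs_mul, abs_two]
  have e4 : ‖1 - D ^ 4 / (normSq D : ℂ) ^ 2‖ = 4 * |D.im| * |D.re| / ‖D‖ ^ 2 := by
    rw [e1, norm_div, norm_mul, norm_mul, e2, e3, norm_pow, norm_pow, norm_real,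
      Real.norm_of_nonneg (normSq_nonneg D), normSq_eq_norm_sq]
    field_simp
    ring
  refine ⟨?_, ?_⟩
  · rw [← norm_pos_iff, e4]; positivity
  · rw [e4]
    have h := norm_le_abs_re_add_abs_im D
    calc ‖D‖⁻¹ * (4 / (4 * |D.im| * |D.re| / ‖D‖ ^ 2)) = ‖D‖ / (|D.im| * |D.re|) := by
          field_simp
      _ ≤ (|D.re| + |D.im|) / (|D.im| * |D.re|) := by gcongr
      _ = _ := by field_simp

lemma latticePt_re (p : ℤ × ℤ) : (latticePt p).re = p.1 + p.2 / 2 := by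
  have h : latticePt p = ((p.1 + p.2 / 2 : ℝ) : ℂ) + ((p.2 * √7 / 2 : ℝ) : ℂ) * I := by
    rw [latticePt, eta]; push_cast; ring
  rw [h]; simp

lemma latticePt_im (p : ℤ × ℤ) : (latticePt p).im = p.2 * √7 / 2 := by
  have h : latticePt p = ((p.1 + p.2 / 2 : ℝ) : ℂ) + ((p.2 * √7 / 2 : ℝ) : ℂ) * I := by
    rw [latticePt, eta]; push_cast; ring
  rw [h]; simp

/-- Multiplication by `-√-7` in the coordinates `(a, b)` of `a + b η`. -/
def mulSqrt (p : ℤ × ℤ) : ℤ × ℤ := (p.1 + 4 * p.2, -(2 * p.1 + p.2))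

lemma mul_conj_re (p q : ℤ × ℤ) :
    (latticePt p * starRingEnd ℂ (latticePt q)).re = pairDet (mulSqrt p) q / 2 := by
  rw [mul_re, conj_re, conj_im, latticePt_re, latticePt_re, latticePt_im, latticePt_im]
  simp only [pairDet, mulSqrt]
  push_cast
  have := Real.sq_sqrt (by norm_num : (0 : ℝ) ≤ 7)
  linear_combination ((p.2 : ℝ) * q.2 / 4) * this

lemma mul_conj_im (p q : ℤ × ℤ) :
    (latticePt p * starRingEnd ℂ (latticePt q)).im = -(√7 / 2 * pairDet p q) := by
  rw [mul_im, conj_re, conj_im, latticePt_re, latticePt_re, latticePt_im, latticePt_im]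
  simp only [pairDet]
  push_cast
  ring

lemma four_mul_normForm_mul (p q : ℤ × ℤ) :
    4 * (normForm p * normForm q) = pairDet (mulSqrt p) q ^ 2 + 7 * pairDet p q ^ 2 := by
  simp only [normForm, pairDet, mulSqrt]; ring

/-- If the real part of αβ̄ vanished, 4N(α)N(β) would be 7 times a square, so 7 would divide one of
the norms and ψ would vanish there. -/
lemma pairDet_mulSqrt_ne_zero {p q : ℤ × ℤ} (hp : eps p ≠ 0) (hq : eps q ≠ 0) :
    pairDet (mulSqrt p) q ≠ 0 := by
  intro h
  have h1 := four_mul_normForm_mul p q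
  rw [h] at h1
  have h7 : (7 : ℤ) ∣ normForm p * normForm q := by omega
  rcases (Int.Prime.dvd_mul' (p := 7) (by norm_num) h7) with h2 | h2
  · exact hp (eps_eq_zero_of_dvd h2)
  · exact hq (eps_eq_zero_of_dvd h2)

/-- Raising i by one raises k by 4, so the phases form a geometric progression with ratio w =
D⁴/|D|⁴. The Poisson weights increase with i and are at most 1, so Abel summation costs a factor 2.
The imaginary and real parts of D are multiples of the two determinants. -/
lemma norm_sum_pair_le {p q : ℤ × ℤ} (hdet : pairDet p q ≠ 0) (N : ℕ) :
    ‖∑ i ∈ Finset.range N, centralTerm (2 * i) p * starRingEnd ℂ (centralTerm (2 * i) q)‖ ≤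
      2 * |(pairDet p q : ℝ)|⁻¹ + 2 * |(pairDet (mulSqrt p) q : ℝ)|⁻¹ := by
  by_cases hp : eps p = 0
  · simp only [centralTerm, hp]
    simp
    positivity
  by_cases hq : eps q = 0
  · simp only [centralTerm, hq]
    simp
    positivity
  have hP := pairDet_mulSqrt_ne_zero hp hq
  have hp0 : p ≠ 0 := by rintro rfl; exact hp eps_zero
  have hq0 : q ≠ 0 := by rintro rfl; exact hq eps_zero
  have hNp : (0 : ℝ) < normForm p := by exact_mod_cast normForm_pos hp0
  have hNq : (0 : ℝ) < normForm q := by exact_mod_cast normForm_pos hq0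
  set D : ℂ := latticePt p * starRingEnd ℂ (latticePt q) with hD
  have hre : D.re = pairDet (mulSqrt p) q / 2 := mul_conj_re p q
  have him : D.im = -(√7 / 2 * pairDet p q) := mul_conj_im p q
  have h7 : 2 ≤ √7 := by
    rw [show (2 : ℝ) = √4 by rw [show (4 : ℝ) = 2 ^ 2 by norm_num, Real.sqrt_sq (by norm_num)]]
    exact Real.sqrt_le_sqrt (by norm_num)
  have hPr : (pairDet (mulSqrt p) q : ℝ) ≠ 0 := by exact_mod_cast hP
  have hQr : (pairDet p q : ℝ) ≠ 0 := by exact_mod_cast hdet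
  have hre0 : D.re ≠ 0 := by rw [hre]; exact div_ne_zero hPr two_ne_zero
  have him0 : D.im ≠ 0 := by
    rw [him]; exact neg_ne_zero.mpr (mul_ne_zero (by positivity) hQr)
  have hsq : normSq D = normForm p * normForm q := by
    rw [hD, normSq_mul, normSq_conj, normSq_latticePt, normSq_latticePt]
  have hNpC : (normForm p : ℂ) ≠ 0 := by exact_mod_cast hNp.ne'
  have hNqC : (normForm q : ℂ) ≠ 0 := by exact_mod_cast hNq.ne'
  set w : ℂ := D ^ 4 / (normSq D : ℂ) ^ 2 with hw
  obtain ⟨h1w, hbound⟩ := inv_norm_mul_inv_norm_one_sub_le hre0 him0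
  rw [← hw] at h1w hbound
  have hDn : 0 < ‖D‖ := norm_pos_iff.mpr fun h ↦ hre0 (by rw [h]; rfl)
  have hwn : ‖w‖ = 1 := by
    rw [hw, norm_div, norm_pow, norm_pow, norm_real, Real.norm_of_nonneg (normSq_nonneg D),
      normSq_eq_norm_sq, ← pow_mul]
    exact div_self (by positivity)
  set g : ℕ → ℝ := fun i ↦ poissonTail (2 * i + 1) (2 * π / 7 * normForm p) *
    poissonTail (2 * i + 1) (2 * π / 7 * normForm q) with hg
  have hxp : 0 ≤ 2 * π / 7 * (normForm p : ℝ) := by positivity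
  have hxq : 0 ≤ 2 * π / 7 * (normForm q : ℝ) := by positivity
  have hterm (i : ℕ) : centralTerm (2 * i) p * starRingEnd ℂ (centralTerm (2 * i) q) =
      (eps p * eps q * (D / (normSq D : ℂ))) * ((g i : ℂ) * w ^ i) := by
    have hsqC : (normSq D : ℂ) = normForm p * normForm q := by exact_mod_cast hsq
    rw [hw, hsqC, hD]
    simp only [centralTerm, hg, map_mul, map_div₀, map_pow, map_intCast, conj_ofReal]
    push_cast
    rw [div_pow, ← pow_mul, ← pow_mul, mul_pow, mul_pow]
    have e1 : ∀ z : ℂ, z ^ (2 * (2 * i) + 1) = z ^ (4 * i) * z := fun z ↦ by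
      rw [← pow_succ]; congr 1; ring
    rw [e1, e1, pow_succ (normForm p : ℂ), pow_succ (normForm q : ℂ)]
    field_simp
  have hgeom (n : ℕ) : ‖∑ i ∈ Finset.range n, w ^ i‖ ≤ 2 / ‖1 - w‖ := by
    have h1 : w ≠ 1 := fun h ↦ h1w (by rw [h, sub_self])
    rw [geom_sum_eq h1, norm_div, ← norm_neg (w - 1), neg_sub]
    gcongr
    refine (norm_sub_le _ _).trans ?_
    rw [norm_pow, hwn]
    norm_num
  have hsum := norm_sum_monotone_mul_le (f := g) (fun i j hij ↦ by
      have hij' : 2 * i + 1 ≤ 2 * j + 1 := by omega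
      exact mul_le_mul (poissonTail_mono hxp hij') (poissonTail_mono hxq hij')
        (poissonTail_nonneg _ hxq) (poissonTail_nonneg _ hxp))
    (fun i ↦ mul_nonneg (poissonTail_nonneg _ hxp) (poissonTail_nonneg _ hxq))
    (fun i ↦ mul_le_one₀ (poissonTail_le_one _ hxp) (poissonTail_nonneg _ hxq)
      (poissonTail_le_one _ hxq)) hgeom N
  have hc : ‖(eps p : ℂ) * eps q * (D / (normSq D : ℂ))‖ ≤ ‖D‖⁻¹ := by
    rw [norm_mul, norm_mul, norm_div, norm_real, Real.norm_of_nonneg (normSq_nonneg D),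
      normSq_eq_norm_sq]
    have h1 := norm_eps_le_one p
    have h2 := norm_eps_le_one q
    have h3 : ‖(eps p : ℂ)‖ * ‖(eps q : ℂ)‖ ≤ 1 := mul_le_one₀ h1 (norm_nonneg _) h2
    have h4 : ‖D‖ / ‖D‖ ^ 2 = ‖D‖⁻¹ := by field_simp
    rw [h4]
    exact mul_le_of_le_one_left (by positivity) h3
  simp only [hterm]
  rw [← Finset.mul_sum, norm_mul]
  calc ‖(eps p : ℂ) * eps q * (D / (normSq D : ℂ))‖ * ‖∑ i ∈ Finset.range N, (g i : ℂ) * w ^ i‖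
      ≤ ‖D‖⁻¹ * (2 * (2 / ‖1 - w‖)) := by gcongr
    _ = ‖D‖⁻¹ * (4 / ‖1 - w‖) := by ring
    _ ≤ |D.im|⁻¹ + |D.re|⁻¹ := hbound
    _ ≤ _ := by
        have hQa : 0 < |(pairDet p q : ℝ)| := abs_pos.mpr hQr
        rw [hre, him, abs_neg, abs_mul, abs_div, abs_div, abs_two,
          abs_of_nonneg (Real.sqrt_nonneg 7), mul_inv, inv_div, inv_div]
        have : 2 / √7 ≤ 2 := by rw [div_le_iff₀ (by positivity)]; linarith
        rw [div_eq_mul_inv 2 |(pairDet (mulSqrt p) q : ℝ)|]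
        gcongr

/-! ### Mean square over a box -/

lemma supNat_le_supNat_mulSqrt (p : ℤ × ℤ) : supNat p ≤ supNat (mulSqrt p) := by
  simp only [supNat, mulSqrt]; omega

lemma supNat_mulSqrt_le (p : ℤ × ℤ) : supNat (mulSqrt p) ≤ 5 * supNat p := by
  simp only [supNat, mulSqrt]; omega

lemma sum_inv_dets_le {R : ℕ} {p : ℤ × ℤ} (hp : p ∈ puncturedBox R) :
    ∑ q ∈ latticeBox R,
      (2 * |(pairDet p q : ℝ)|⁻¹ + 2 * |(pairDet (mulSqrt p) q : ℝ)|⁻¹) ≤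
      64 * R * (1 + Real.log (10 * R ^ 2)) * (supNat p : ℝ)⁻¹ := by
  obtain ⟨hpR, hp0⟩ := mem_puncturedBox.mp hp
  have hpos := supNat_pos hp0
  have hle := supNat_le_supNat_mulSqrt p
  have hm0 : mulSqrt p ≠ 0 := by
    intro h
    rw [h] at hle
    simp [supNat] at hle
    simp only [supNat] at hpos
    omega
  have h1 := sum_inv_det_le hp0 (by omega : supNat p ≤ 5 * R)
  have h2 := sum_inv_det_le hm0 (by have := supNat_mulSqrt_le p; omega : supNat (mulSqrt p) ≤ 5 * R)
  have hR : (1 : ℝ) ≤ R := by exact_mod_cast (by omega : 1 ≤ R)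
  have hlog : 0 ≤ Real.log (10 * R ^ 2) := Real.log_nonneg (by nlinarith)
  have hposr : (0 : ℝ) < supNat p := by exact_mod_cast hpos
  have h3 : 16 * R * (1 + Real.log (10 * R ^ 2)) * (supNat (mulSqrt p) : ℝ)⁻¹ ≤
      16 * R * (1 + Real.log (10 * R ^ 2)) * (supNat p : ℝ)⁻¹ := by
    gcongr
  rw [Finset.sum_add_distrib, ← Finset.mul_sum, ← Finset.mul_sum]
  simp only [pairDet] at *
  linarith

/-- Pairs are split by whether their determinant vanishes. Parallel pairs cost 14 · 16 = 224 for
each i; for the others the sum over i is taken first, and the total is 64 · 8 = 512 times R² log. -/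
lemma sum_norm_sq_crop_le (N R : ℕ) :
    ∑ i ∈ Finset.range N, ‖∑ p ∈ puncturedBox R, centralTerm (2 * i) p‖ ^ 2 ≤
      224 * N * (1 + Real.log R) ^ 2 + 512 * R ^ 2 * (1 + Real.log (10 * R ^ 2)) := by
  set c : ℕ → ℤ × ℤ → ℂ := fun i ↦ centralTerm (2 * i) with hc
  set B := puncturedBox R
  have hexp (i : ℕ) : ((‖∑ p ∈ B, c i p‖ ^ 2 : ℝ) : ℂ) =
      ∑ p ∈ B, c i p * starRingEnd ℂ (∑ q ∈ B.filter (fun q ↦ pairDet p q = 0), c i q) +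
      ∑ p ∈ B, ∑ q ∈ B.filter (fun q ↦ ¬ pairDet p q = 0), c i p * starRingEnd ℂ (c i q) := by
    rw [ofReal_pow, ← mul_conj', map_sum, Finset.sum_mul_sum, ← Finset.sum_add_distrib]
    refine Finset.sum_congr rfl fun p _ ↦ ?_
    rw [map_sum, Finset.mul_sum, Finset.sum_filter_add_sum_filter_not]
  have hpar (i : ℕ) : ‖∑ p ∈ B, c i p *
      starRingEnd ℂ (∑ q ∈ B.filter (fun q ↦ pairDet p q = 0), c i q)‖ ≤
      224 * (1 + Real.log R) ^ 2 := by
    calc ‖∑ p ∈ B, c i p * starRingEnd ℂ (∑ q ∈ B.filter (fun q ↦ pairDet p q = 0), c i q)‖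
        ≤ ∑ p ∈ B, 14 * ((Int.gcd p.1 p.2 : ℝ) / normForm p) := by
          refine norm_sum_le_of_le _ fun p hp ↦ ?_
          have hp0 := (mem_puncturedBox.mp hp).2
          rw [norm_mul, RCLike.norm_conj]
          have h1 : ‖c i p‖ ≤ ‖latticePt p‖⁻¹ := norm_centralTerm_le_inv _ p
          have h2 := norm_sum_parallel_le (2 * i) R hp0
          calc _ ≤ ‖latticePt p‖⁻¹ * (14 * (Int.gcd p.1 p.2 : ℝ) * ‖latticePt p‖⁻¹) :=
                mul_le_mul h1 h2 (norm_nonneg _) (by positivity)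
            _ = _ := by rw [← norm_latticePt_sq]; field_simp
      _ ≤ _ := by
          rw [← Finset.mul_sum]
          linarith [sum_gcd_div_normForm_le R]
  have hoff : ‖∑ i ∈ Finset.range N, ∑ p ∈ B, ∑ q ∈ B.filter (fun q ↦ ¬ pairDet p q = 0),
      c i p * starRingEnd ℂ (c i q)‖ ≤ 512 * R ^ 2 * (1 + Real.log (10 * R ^ 2)) := by
    rw [Finset.sum_comm]
    calc ‖∑ p ∈ B, ∑ i ∈ Finset.range N, ∑ q ∈ B.filter (fun q ↦ ¬ pairDet p q = 0),
          c i p * starRingEnd ℂ (c i q)‖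
        ≤ ∑ p ∈ B, 64 * R * (1 + Real.log (10 * R ^ 2)) * (supNat p : ℝ)⁻¹ := by
          refine norm_sum_le_of_le _ fun p hp ↦ ?_
          rw [Finset.sum_comm]
          refine le_trans ?_ (sum_inv_dets_le hp)
          refine (norm_sum_le_of_le _ fun q hq ↦
            norm_sum_pair_le (Finset.mem_filter.mp hq).2 N).trans ?_
          exact Finset.sum_le_sum_of_subset_of_nonneg
            ((Finset.filter_subset _ _).trans (Finset.filter_subset _ _))
            fun q _ _ ↦ by positivity
      _ = _ := by rw [← Finset.mul_sum, sum_puncturedBox_inv]; ring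
  have htotal : ((∑ i ∈ Finset.range N, ‖∑ p ∈ B, c i p‖ ^ 2 : ℝ) : ℂ) =
      ∑ i ∈ Finset.range N, ∑ p ∈ B, c i p *
        starRingEnd ℂ (∑ q ∈ B.filter (fun q ↦ pairDet p q = 0), c i q) +
      ∑ i ∈ Finset.range N, ∑ p ∈ B, ∑ q ∈ B.filter (fun q ↦ ¬ pairDet p q = 0),
        c i p * starRingEnd ℂ (c i q) := by
    rw [ofReal_sum, Finset.sum_congr rfl fun i _ ↦ hexp i, Finset.sum_add_distrib]
  have hnn : 0 ≤ ∑ i ∈ Finset.range N, ‖∑ p ∈ B, c i p‖ ^ 2 := by positivity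
  have h := congrArg norm htotal
  rw [norm_real, Real.norm_of_nonneg hnn] at h
  rw [h]
  refine (norm_add_le _ _).trans (add_le_add ?_ hoff)
  refine (norm_sum_le_of_le _ fun i _ ↦ hpar i).trans (le_of_eq ?_)
  rw [Finset.sum_const, Finset.card_range, nsmul_eq_mul]
  ring

/-! ### Truncation and final estimates -/

/-- A bound for the part of the central value coming from lattice points outside a large box. -/
noncomputable def tailBound : ℝ := ∑' p : ℤ × ℤ, Real.exp (-(2 * π / 7 * normForm p) * (1 / 4))

lemma tailBound_nonneg : 0 ≤ tailBound := tsum_nonneg fun _ ↦ (Real.exp_pos _).le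

/-- Outside the box the norm is at least (R + 1)²/2, so `poissonTail_le_of_le` applies and the
remainder is bounded uniformly in m and R. -/
lemma norm_tsum_centralTerm_sub_le {m R : ℕ} (h : 4 * ((m : ℝ) + 1) ≤ π / 7 * (R + 1) ^ 2) :
    ‖∑' p, centralTerm m p - ∑ p ∈ puncturedBox R, centralTerm m p‖ ≤ tailBound := by
  have h1 : HasSum (fun p ↦ if p ∈ puncturedBox R then centralTerm m p else 0)
      (∑ p ∈ puncturedBox R, centralTerm m p) := by
    have h2 := hasSum_sum_of_ne_finset_zero (L := .unconditional _) (s := puncturedBox R)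
      (f := fun p ↦ if p ∈ puncturedBox R then centralTerm m p else 0) fun p hp ↦ if_neg hp
    rwa [Finset.sum_congr rfl fun p hp ↦ if_pos hp] at h2
  have h3 := (summable_centralTerm m).hasSum.sub h1
  rw [← h3.tsum_eq]
  have hs := summable_exp_mul_norm_pow (by norm_num : (0 : ℝ) < 1 / 4) 0
  simp only [pow_zero, mul_one] at hs
  refine tsum_of_norm_bounded hs.hasSum fun p ↦ ?_
  split_ifs with hp
  · simp only [sub_self, norm_zero]; positivity
  · rw [sub_zero]
    rcases eq_or_ne p 0 with rfl | hp0
    · simp only [centralTerm, eps_zero]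
      simp
      positivity
    have hsup : R + 1 ≤ supNat p := by
      by_contra hlt
      exact hp (mem_puncturedBox.mpr ⟨by omega, hp0⟩)
    have hsupr : (R + 1 : ℝ) ≤ supNat p := by exact_mod_cast hsup
    have hN := supNat_sq_le p
    have hN2 : (R + 1 : ℝ) ^ 2 ≤ 2 * normForm p := by
      have : (R + 1 : ℝ) ^ 2 ≤ (supNat p : ℝ) ^ 2 := by gcongr
      linarith
    have hx : 4 * ((m + 1 : ℕ) : ℝ) ≤ 2 * π / 7 * normForm p := by
      have := mul_le_mul_of_nonneg_left hN2 (by positivity : 0 ≤ π / 7)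
      push_cast
      linarith
    have hinv := inv_le_one_of_one_le₀ (one_le_norm_latticePt hp0)
    have hx0 : 0 ≤ 2 * π / 7 * (normForm p : ℝ) := le_trans (by positivity) hx
    refine (norm_centralTerm_le m p).trans ((mul_le_of_le_one_left
      (poissonTail_nonneg _ hx0) hinv).trans ((poissonTail_le_of_le hx).trans (le_of_eq ?_)))
    congr 1
    ring

/-- The side of the box used to truncate the central values with `n ≤ N`. -/
def cropRadius (N : ℕ) : ℕ := 5 * (Nat.sqrt N + 1)

/-- The left side is at most 8N, while the factor 5 makes the right side at least 3 · 25N/7. -/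
lemma cropRadius_spec {N i : ℕ} (hi : i < N) :
    4 * (((2 * i : ℕ) : ℝ) + 1) ≤ π / 7 * ((cropRadius N : ℝ) + 1) ^ 2 := by
  have h1 : N < (Nat.sqrt N + 1) * (Nat.sqrt N + 1) := Nat.lt_succ_sqrt N
  have h2 : (N : ℝ) ≤ ((Nat.sqrt N : ℝ) + 1) ^ 2 := by rw [sq]; exact_mod_cast h1.le
  have h3 : (25 * N : ℝ) ≤ ((cropRadius N : ℝ) + 1) ^ 2 := by
    rw [cropRadius]
    push_cast
    have : (0 : ℝ) ≤ Nat.sqrt N := Nat.cast_nonneg _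
    nlinarith
  have h4 : (i : ℝ) + 1 ≤ N := by exact_mod_cast hi
  have h5 : 3 * ((cropRadius N : ℝ) + 1) ^ 2 ≤ π * ((cropRadius N : ℝ) + 1) ^ 2 := by
    gcongr
    exact Real.pi_gt_three.le
  push_cast
  have : (0 : ℝ) ≤ i := Nat.cast_nonneg _
  linarith

lemma cropRadius_le {N : ℕ} (hN : 1 ≤ N) : (cropRadius N : ℝ) ≤ 10 * √N := by
  have h1 : 1 ≤ Nat.sqrt N := Nat.sqrt_pos.mpr hN
  have h2 : (1 : ℝ) ≤ Nat.sqrt N := by exact_mod_cast h1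
  have h3 : (Nat.sqrt N : ℝ) ≤ √N := Real.nat_sqrt_le_real_sqrt
  rw [cropRadius]
  push_cast
  linarith

lemma norm_heckeL_center_le_crop {N i : ℕ} (hi : i < N) :
    ‖heckeL (2 * (2 * i) + 1) (1 / 2)‖ ≤
      ‖∑ p ∈ puncturedBox (cropRadius N), centralTerm (2 * i) p‖ + tailBound := by
  have h1 := norm_heckeL_center_le (2 * i)
  have h2 := norm_tsum_centralTerm_sub_le (cropRadius_spec hi)
  have h3 := norm_sub_norm_le (∑' p, centralTerm (2 * i) p)
    (∑ p ∈ puncturedBox (cropRadius N), centralTerm (2 * i) p)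
  linarith

lemma one_le_two_mul_log {N : ℕ} (hN : 2 ≤ N) : 1 ≤ 2 * Real.log N := by
  have h1 : Real.log 2 ≤ Real.log N := Real.log_le_log two_pos (by exact_mod_cast hN)
  linarith [Real.log_two_gt_d9]

/-- The terms are estimated by absolute values, which already gives O(√n); the logarithm enters only
through 1 ≤ 2 log n. -/
lemma convexity_bound (n : ℕ) (hn : 2 ≤ n) : ‖heckeL (4 * n - 3) (1 / 2)‖ ≤
    (320 + 2 * tailBound) * (√n * Real.log n) := by
  obtain ⟨i, rfl⟩ := Nat.exists_eq_add_of_le' (by omega : 1 ≤ n)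
  rw [show 4 * (i + 1) - 3 = 2 * (2 * i) + 1 by omega]
  have h1 := norm_heckeL_center_le_crop (Nat.lt_succ_self i)
  have h2 : ‖∑ p ∈ puncturedBox (cropRadius (i + 1)), centralTerm (2 * i) p‖ ≤
      16 * cropRadius (i + 1) :=
    (norm_sum_le_of_le _ fun p _ ↦ norm_centralTerm_le_inv _ p).trans (sum_norm_inv_le _)
  have h3 := cropRadius_le (Nat.succ_le_succ (Nat.zero_le i))
  have h4 := one_le_two_mul_log hn
  have h5 : 1 ≤ √((i + 1 : ℕ) : ℝ) := Real.one_le_sqrt.mpr (by exact_mod_cast (by omega : 1 ≤ i + 1))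
  have h6 := tailBound_nonneg
  calc ‖heckeL (2 * (2 * i) + 1) (1 / 2)‖ ≤ 160 * √((i + 1 : ℕ) : ℝ) + tailBound * 1 := by
        simp only [Nat.succ_eq_add_one] at *
        linarith
    _ ≤ 160 * √((i + 1 : ℕ) : ℝ) + tailBound * √((i + 1 : ℕ) : ℝ) := by gcongr
    _ = (160 + tailBound) * √((i + 1 : ℕ) : ℝ) * 1 := by ring
    _ ≤ (160 + tailBound) * √((i + 1 : ℕ) : ℝ) * (2 * Real.log ((i + 1 : ℕ) : ℝ)) := by gcongr
    _ = _ := by ring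

lemma sum_norm_sq_heckeL_le (N : ℕ) (hN : 2 ≤ N) :
    ∑ i ∈ Finset.range N, ‖heckeL (2 * (2 * i) + 1) (1 / 2)‖ ^ 2 ≤
      (2 * (224 * 57 + 512 * 2600) + 8 * tailBound ^ 2) * (N * Real.log N ^ 2) := by
  set L := Real.log N with hL
  set R := cropRadius N with hR
  have hNr : (2 : ℝ) ≤ N := by exact_mod_cast hN
  have h1 := sum_norm_sq_crop_le N R
  have hlog1 : 1 ≤ 2 * L := one_le_two_mul_log hN
  have hRle : (R : ℝ) ≤ 10 * √N := cropRadius_le (by omega)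
  have hR1 : (1 : ℝ) ≤ R := by
    have : 1 ≤ R := by rw [hR, cropRadius]; omega
    exact_mod_cast this
  have hsq : √(N : ℝ) ^ 2 = N := Real.sq_sqrt (by positivity)
  have hR2 : (R : ℝ) ^ 2 ≤ 100 * N := by
    calc (R : ℝ) ^ 2 ≤ (10 * √N) ^ 2 := by gcongr
      _ = 100 * (N : ℝ) := by rw [mul_pow, hsq]; ring
  have hlogR2 : Real.log (10 * R ^ 2) ≤ 11 * L := by
    calc Real.log (10 * R ^ 2) ≤ Real.log ((N : ℝ) ^ 11) := by
          apply Real.log_le_log (by positivity)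
          -- This absorbs the constant, since 1000 ≤ 2^10.
          have h10 : (2 : ℝ) ^ 10 ≤ (N : ℝ) ^ 10 := by gcongr
          calc 10 * (R : ℝ) ^ 2 ≤ 1000 * N := by linarith
            _ ≤ (N : ℝ) ^ 10 * N := by gcongr; linarith
            _ = _ := by ring
      _ = 11 * L := by rw [Real.log_pow, hL]; norm_num
  have hlogR : Real.log R ≤ 5.5 * L := by
    have : Real.log ((R : ℝ) ^ 2) ≤ Real.log (10 * R ^ 2) :=
      Real.log_le_log (by positivity) (by nlinarith)
    rw [Real.log_pow] at this
    push_cast at this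
    linarith
  have hlogR0 : 0 ≤ Real.log R := Real.log_nonneg hR1
  have hlogR20 : 0 ≤ Real.log (10 * R ^ 2) := Real.log_nonneg (by nlinarith)
  have hL0 : 0 ≤ L := by linarith
  -- From 1 ≤ 2L, the base is at most 7.5L, and 7.5² < 57.
  have hA : (1 + Real.log R) ^ 2 ≤ 57 * L ^ 2 := by
    calc (1 + Real.log R) ^ 2 ≤ (7.5 * L) ^ 2 := by gcongr; linarith
      _ ≤ 57 * L ^ 2 := by nlinarith [sq_nonneg L]
  -- Here 1 + 11L ≤ 13L ≤ 26L², again by 1 ≤ 2L.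
  have hB : (R : ℝ) ^ 2 * (1 + Real.log (10 * R ^ 2)) ≤ 2600 * N * L ^ 2 := by
    calc (R : ℝ) ^ 2 * (1 + Real.log (10 * R ^ 2)) ≤ 100 * N * (26 * L ^ 2) := by
          gcongr
          nlinarith
      _ = _ := by ring
  have hK : N * tailBound ^ 2 ≤ 4 * tailBound ^ 2 * (N * L ^ 2) := by
    have h2 : 1 ≤ 4 * L ^ 2 := by nlinarith
    calc N * tailBound ^ 2 = N * tailBound ^ 2 * 1 := by ring
      _ ≤ N * tailBound ^ 2 * (4 * L ^ 2) := by gcongr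
      _ = _ := by ring
  have hA' : 224 * N * (1 + Real.log R) ^ 2 ≤ 224 * N * (57 * L ^ 2) := by gcongr
  calc ∑ i ∈ Finset.range N, ‖heckeL (2 * (2 * i) + 1) (1 / 2)‖ ^ 2
      ≤ ∑ i ∈ Finset.range N, (2 * ‖∑ p ∈ puncturedBox R, centralTerm (2 * i) p‖ ^ 2 +
          2 * tailBound ^ 2) := by
        refine Finset.sum_le_sum fun i hi ↦ ?_
        have h2 := norm_heckeL_center_le_crop (Finset.mem_range.mp hi)
        rw [← hR] at h2
        have h3 := pow_le_pow_left₀ (norm_nonneg _) h2 2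
        nlinarith [sq_nonneg (‖∑ p ∈ puncturedBox R, centralTerm (2 * i) p‖ - tailBound)]
    _ = 2 * ∑ i ∈ Finset.range N, ‖∑ p ∈ puncturedBox R, centralTerm (2 * i) p‖ ^ 2 +
          2 * (N * tailBound ^ 2) := by
        rw [Finset.sum_add_distrib, ← Finset.mul_sum, Finset.sum_const, Finset.card_range,
          nsmul_eq_mul]
        ring
    _ ≤ _ := by linarith

lemma moment_two_eq (N : ℕ) : moment 2 N =
    (1 / (N : ℂ)) * ∑ i ∈ Finset.range N, heckeL (2 * (2 * i) + 1) (1 / 2) ^ 2 := by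
  have h := Finset.sum_Ico_add' (fun n ↦ heckeL (4 * n - 3) (1 / 2) ^ 2) 0 N 1
  simp only [show ∀ i, 4 * (i + 1) - 3 = 2 * (2 * i) + 1 by omega, zero_add] at h
  rw [moment, ← Finset.Ico_add_one_right_eq_Icc, ← h, Finset.range_eq_Ico]

theorem theorem2 :
    (∀ n : ℕ, 1 ≤ n → IsHeckeL (4 * n - 3) (heckeL (4 * n - 3))) ∧
    (∃ C : ℝ, ∀ N : ℕ, 2 ≤ N → ‖moment 2 N‖ ≤ C * Real.log N ^ 2) ∧
    (∃ C : ℝ, ∀ n : ℕ, 2 ≤ n →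
      ‖heckeL (4 * n - 3) (1 / 2)‖ ≤ C * (Real.sqrt n * Real.log n)) := by
  -- The exponent 4n - 3 is a truncated subtraction; for n ≥ 1 it equals 2(2n - 2) + 1, which is
  -- odd.
  refine ⟨fun n hn ↦ isHeckeL_heckeL ⟨2 * n - 2, by omega⟩,
    ⟨2 * (224 * 57 + 512 * 2600) + 8 * tailBound ^ 2, fun N hN ↦ ?_⟩, ⟨_, convexity_bound⟩⟩
  have hN0 : (0 : ℝ) < N := by exact_mod_cast (by omega : 0 < N)
  rw [moment_two_eq, norm_mul, norm_div, norm_one, norm_natCast, one_div, inv_mul_le_iff₀ hN0]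
  refine (norm_sum_le_of_le _ fun i _ ↦ (norm_pow _ 2).le).trans ?_
  refine (sum_norm_sq_heckeL_le N hN).trans (le_of_eq ?_)
  ring
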